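/- Setting. For $i=1,\dots,M$ let $X_i\subset\mathbb{R}^{n_i}$ be closed, convex and bounded with nonempty interior, let $F_i$ be a (standard) self-concordant barrier for $X_i$ with domain $\operatorname{int}X_i$ and some parameter $\nu_i$, let $c_i\in\mathbb{R}^{n_i}$, $A_i\in\mathbb{R}^{m\times n_i}$, $b\in\mathbb{R}^m$, and let $A=[A_1,\dots,A_M]$ have full row rank. Put $X=X_1\times\cdots\times X_M$, $c=(c_1,\dots,c_M)$, $F(x)=\sum_iF_i(x_i)$, $x_i^c=\arg\min_{\operatorname{int}X_i}F_i$, and write $\|u\|_x=[u^T\nabla^2F(x)u]^{1/2}$ for $x\in\operatorname{int}X$. For $y\in\mathbb{R}^m$, $t>0$ let $$d(y,t)=\sum_{i=1}^M\max_{x_i\in\operatorname{int}X_i}\{c_i^Tx_i+y^TA_ix_i-t[F_i(x_i)-F_i(x_i^c)]\}-b^Ty ,$$ let $x^*(y,t)\in\operatorname{int}X$ be the unique vector of maximizers, let $\tilde d(\cdot,t)=\frac1td(\cdot,t)$, and let $\lambda(y,t)=[\nabla\tilde d(y,t)^T\nabla^2\tilde d(y,t)^{-1}\nabla\tilde d(y,t)]^{1/2}$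 be its Newton decrement (derivatives in $y$). Let $\bar x(y,t)$ be an approximation of $x^*(y,t)$, and put $$g(y,t)=A\bar x(y,t)-b,\qquad H(y,t)=\tfrac1tA\nabla^2F(\bar x(y,t))^{-1}A^T,$$ $$\bar\lambda(y,t)=\Big[\big(\tfrac1tg\big)^T\big(\tfrac1tH\big)^{-1}\big(\tfrac1tg\big)\Big]^{1/2},\qquad \delta(y,t)=\|\bar x(y,t)-x^*(y,t)\|_{x^*(y,t)} .$$ Statement. Let $y\in\mathbb{R}^m$, $0<\Delta t<t$, let $\bar x(y,t)\in\operatorname{int}X$, and let $(y_+,t_+)$ be given by one inexact perturbed full-step path-following step $$t_+=t-\Delta t,\qquad y_+=y-H(y,t_+)^{-1}g(y,t_+).$$ Write $\bar\lambda=\bar\lambda(y,t)$, $\bar\lambda_+=\bar\lambda(y_+,t_+)$, $\lambda=\lambda(y,t)$, $\lambda_+=\lambda(y_+,t_+)$, $\delta=\delta(y,t)$, $\delta_1=\delta(y,t_+)$, $\delta_+=\delta(y_+,t_+)$, $\Delta=\|\bar x(y,t_+)-\bar x(y,t)\|_{\bar x(y,t)}$ and $\Delta^*=\|x^*(y,t_+)-x^*(y,t)\|_{x^*(y,t)}$.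 1. If $\delta_1+2\Delta+\bar\lambda<1$ and $\delta_+<1$, then with $\xi=\frac{\Delta+\bar\lambda}{1-\delta_1-2\Delta-\bar\lambda}$, $$\bar\lambda_+\le\frac1{1-\delta_+}\Big\{\delta_++\delta_1+\xi^2+\delta_1\big[(1-\delta_1)^{-2}+2(1-\delta_1)^{-1}\big]\xi\Big\}.$$ 2. The right-hand side, as a function of $(\delta_+,\delta_1,\Delta,\bar\lambda)$ on the set of nonnegative quadruples with $\delta_1+2\Delta+\bar\lambda<1$ and $\delta_+<1$, is nondecreasing in every variable. 3. In the exact case $\delta=\delta_1=\delta_+=0$ one has $\bar\lambda_+=\lambda_+$, $\bar\lambda=\lambda$, $\Delta=\Delta^*$, and if $\lambda+2\Delta^*<1$, then $$\lambda_+\le\Big(\frac{\lambda+\Delta^*}{1-2\Delta^*-\lambda}\Big)^2 .$$ -/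

import Mathlib

open scoped Matrix

noncomputable section

namespace PathFollowing

/-! Vectors are functions `κ → ℝ` on a finite index type `κ`, with the Euclidean inner product
`u ⬝ᵥ v`. Only topological notions and derivatives are used on this space (never its norm), so
everything agrees with the Euclidean space of the same dimension. -/

section Calculus

variable {κ : Type*} [Fintype κ] [DecidableEq κ]

/-- The gradient vector of `f` at `x`. -/
def grad (f : (κ → ℝ) → ℝ) (x : κ → ℝ) : κ → ℝ :=
  fun i => fderiv ℝ f x (Pi.single i 1)

/-- The Hessian matrix of `f` at `x`. -/
def hess (f : (κ → ℝ) → ℝ) (x : κ → ℝ) : Matrix κ κ ℝ :=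
  Matrix.of fun i j => iteratedFDeriv ℝ 2 f x ![Pi.single i 1, Pi.single j 1]

/-- The local norm `‖u‖ₓ = (uᵀ ∇²f(x) u)^{1/2}`. -/
def localNorm (f : (κ → ℝ) → ℝ) (x u : κ → ℝ) : ℝ :=
  Real.sqrt (u ⬝ᵥ (hess f x *ᵥ u))

/-- The quantity `(gᵀ H⁻¹ g)^{1/2}`: the dual norm of `g` for the norm given by `H`. -/
def dualNorm (H : Matrix κ κ ℝ) (g : κ → ℝ) : ℝ :=
  Real.sqrt (g ⬝ᵥ (H⁻¹ *ᵥ g))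

/-- The Newton decrement of `f` at `x`. -/
def newtonDecrement (f : (κ → ℝ) → ℝ) (x : κ → ℝ) : ℝ :=
  dualNorm (hess f x) (grad f x)

/-- `f` is a standard self-concordant function with (open) domain `D`: it is three times
continuously differentiable and convex on `D`, closed (its epigraph is closed), and
`|D³f(x)[u,u,u]| ≤ 2 (uᵀ ∇²f(x) u)^{3/2}`. -/
structure IsSelfConcordant (D : Set (κ → ℝ)) (f : (κ → ℝ) → ℝ) : Prop where
  isOpen : IsOpen D
  contDiffOn : ContDiffOn ℝ 3 f D
  convexOn : ConvexOn ℝ D f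
  closed : IsClosed {p : (κ → ℝ) × ℝ | p.1 ∈ D ∧ f p.1 ≤ p.2}
  third_le : ∀ x ∈ D, ∀ u : κ → ℝ,
    |iteratedFDeriv ℝ 3 f x ![u, u, u]| ≤ 2 * localNorm f x u ^ 3

/-- `f` is a self-concordant barrier with parameter `ν` for the set `X`; its domain is the
interior of `X`. -/
structure IsSelfConcordantBarrier (X : Set (κ → ℝ)) (f : (κ → ℝ) → ℝ) (ν : ℝ) : Prop where
  selfConcordant : IsSelfConcordant (interior X) f
  barrier : ∀ x ∈ interior X, ∀ u : κ → ℝ,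
    2 * (grad f x ⬝ᵥ u) - u ⬝ᵥ (hess f x *ᵥ u) ≤ ν

end Calculus

/-- A maximizer of `f` over `S` (an arbitrary point if there is none). -/
def argmaxOn {E : Type*} [Nonempty E] (S : Set E) (f : E → ℝ) : E :=
  Classical.epsilon fun x => x ∈ S ∧ IsMaxOn f S x

/-- The data of a separable problem with linear objective,
`max ∑ᵢ cᵢᵀ xᵢ` subject to `xᵢ ∈ Xᵢ` and `∑ᵢ Aᵢ xᵢ = b`, with a function `Fᵢ` for each `Xᵢ`.
No property of the data is assumed here. -/
structure SeparableProblem (M m : ℕ) (n : Fin M → ℕ) where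
  X : ∀ i, Set (Fin (n i) → ℝ)
  c : ∀ i, Fin (n i) → ℝ
  A : ∀ i, Matrix (Fin m) (Fin (n i)) ℝ
  b : Fin m → ℝ
  F : ∀ i, (Fin (n i) → ℝ) → ℝ

/-- The full primal space: vectors `x = (x₁, …, x_M)`. -/
abbrev PrimalVec {M : ℕ} (n : Fin M → ℕ) : Type := (Σ i, Fin (n i)) → ℝ

/-- The component `xᵢ` of `x = (x₁, …, x_M)`. -/
def block {M : ℕ} {n : Fin M → ℕ} (x : PrimalVec n) (i : Fin M) : Fin (n i) → ℝ :=
  fun j => x ⟨i, j⟩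

namespace SeparableProblem

variable {M m : ℕ} {n : Fin M → ℕ} (P : SeparableProblem M m n)

/-- The matrix `A = [A₁, …, A_M]`. -/
def fullA : Matrix (Fin m) (Σ i, Fin (n i)) ℝ :=
  Matrix.of fun r p => P.A p.1 r p.2

/-- The function `F(x) = ∑ᵢ Fᵢ(xᵢ)`. -/
def fullF (x : PrimalVec n) : ℝ := ∑ i, P.F i (block x i)

/-- The domain of `F`, i.e. `int X₁ × ⋯ × int X_M`. -/
def domF : Set (PrimalVec n) := {x | ∀ i, block x i ∈ interior (P.X i)}

/-- The analytic center of `Xᵢ`. -/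
def analyticCenter (i : Fin M) : Fin (n i) → ℝ :=
  argmaxOn (interior (P.X i)) (fun x => -P.F i x)

/-- The objective `cᵢᵀ x + yᵀ Aᵢ x - t [Fᵢ(x) - Fᵢ(xᵢᶜ)]` of the `i`-th primal subproblem. -/
def subObjective (i : Fin M) (y : Fin m → ℝ) (t : ℝ) (x : Fin (n i) → ℝ) : ℝ :=
  P.c i ⬝ᵥ x + y ⬝ᵥ (P.A i *ᵥ x) - t * (P.F i x - P.F i (P.analyticCenter i))

/-- The smooth dual function `d(y,t) = ∑ᵢ max_{x ∈ int Xᵢ} (subObjective) - bᵀ y`. -/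
def smoothDual (y : Fin m → ℝ) (t : ℝ) : ℝ :=
  (∑ i, sSup (P.subObjective i y t '' interior (P.X i))) - P.b ⬝ᵥ y

/-- The solution `x*(y,t) = (x₁*(y,t), …, x_M*(y,t))` of the primal subproblems. -/
def xstar (y : Fin m → ℝ) (t : ℝ) : PrimalVec n :=
  fun p => argmaxOn (interior (P.X p.1)) (P.subObjective p.1 y t) p.2

/-- The exact Newton decrement at `y` of `(1/t) d(·,t)`. -/
def decrement (y : Fin m → ℝ) (t : ℝ) : ℝ :=
  newtonDecrement (fun z => t⁻¹ * P.smoothDual z t) y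

/-- The approximate gradient `A x̄ - b` of `d(·,t)`. -/
def inexactGrad (xbar : PrimalVec n) : Fin m → ℝ :=
  P.fullA *ᵥ xbar - P.b

/-- The approximate Hessian `(1/t) A ∇²F(x̄)⁻¹ Aᵀ` of `d(·,t)`. -/
def inexactHess (xbar : PrimalVec n) (t : ℝ) : Matrix (Fin m) (Fin m) ℝ :=
  t⁻¹ • (P.fullA * (hess P.fullF xbar)⁻¹ * P.fullAᵀ)

/-- The inexact Newton decrement of `(1/t) d(·,t)`, computed from `x̄`. -/
def inexactDecrement (xbar : PrimalVec n) (t : ℝ) : ℝ :=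
  dualNorm (t⁻¹ • P.inexactHess xbar t) (t⁻¹ • P.inexactGrad xbar)

/-- The error `‖x̄ - x*(y,t)‖` in the local norm at `x*(y,t)`. -/
def solError (xbar : PrimalVec n) (y : Fin m → ℝ) (t : ℝ) : ℝ :=
  localNorm P.fullF (P.xstar y t) (xbar - P.xstar y t)

end SeparableProblem

/-- The quantity `ξ = (Δ + λ) / (1 - δ₁ - 2Δ - λ)`. -/
def xi (δ₁ Δ lam : ℝ) : ℝ := (Δ + lam) / (1 - δ₁ - 2 * Δ - lam)

/-- The right-hand side of the main estimate, as a function of `δ₊, δ₁, Δ, λ`. -/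
def mainBound (δp δ₁ Δ lam : ℝ) : ℝ :=
  (1 - δp)⁻¹ * (δp + δ₁ + xi δ₁ Δ lam ^ 2
    + δ₁ * (((1 - δ₁) ^ 2)⁻¹ + 2 * (1 - δ₁)⁻¹) * xi δ₁ Δ lam)

end PathFollowing

end

set_option linter.unusedSectionVars false

/-! Everything reduces to one statement about a single self-concordant `f` on a bounded domain. With
`f = F`, the solution `x*(y,t)` is the point where `∇F` equals the slope `t⁻¹(c + Aᵀy)`. Hence
`t⁻¹d(·,t)` is, up to an affine term, the conjugate of `F` composed with an affine map, and its
decrement is the norm of `Ax* - b` dual to `S(x) = A ∇²F(x)⁻¹ Aᵀ`. The inexact decrement is the same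
expression at `x̄`; all powers of `t` cancel.

Let `x, x₁, x₂` be the old, intermediate and new approximations, `a, c` the exact counterparts of
`x₁, x₂`, and `g₁ = Ax₁ - b`. The step shifts the slope by `v = -Aᵀ S(x₁)⁻¹ g₁`, so `∇f(c) = ∇f(a) +
v` while `A ∇²f(x₁)⁻¹ v = -g₁`. Therefore `Ax₂ - b = A(x₂ - c + w)` with `w = c - x₁ - ∇²f(x₁)⁻¹v`.
The dual norm of `Az` never exceeds the local norm of `z` (`dualNorm_mulVec_le`), so it suffices to
bound `w`. Split `w = -(x₁ - a) + (c - a - ∇²f(a)⁻¹v) + (∇²f(a)⁻¹ - ∇²f(x₁)⁻¹)v`. The first term is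
the error `δ₁`. The second is a quadratic Newton error (`newton_error`). The third is a Hessian
mismatch (`matNorm_inv_sub_inv_le`). With `σ` the dual norm of `v` at `a`, one has `σ/(1-σ) ≤ ξ`,
which gives the stated bound (`step_bound_le`).

The analytic input is the comparison of Hessians along curves (`hess_comparison`). It rests on the
polarized inequality `|T(h,u,u)| ≤ 2‖h‖‖u‖²` with no loss of constant. The Newton error follows by
differentiating `(∇f)⁻¹` twice along the segment from `∇f(a)` to `∇f(c)`. -/

noncomputable section

namespace PathFollowing

/-! ### Norms of positive definite matrices and their duals. -/

section LinearAlgebra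

variable {κ ι : Type*} [Fintype κ] [DecidableEq κ] [Fintype ι] [DecidableEq ι]

/-- The (semi)norm `(uᵀ H u)^{1/2}` of a positive (semi)definite matrix `H`. -/
def matNorm (H : Matrix κ κ ℝ) (u : κ → ℝ) : ℝ := Real.sqrt (u ⬝ᵥ (H *ᵥ u))

theorem localNorm_eq_matNorm (f : (κ → ℝ) → ℝ) (x u : κ → ℝ) :
    localNorm f x u = matNorm (hess f x) u := rfl

theorem dualNorm_eq_matNorm (H : Matrix κ κ ℝ) (g : κ → ℝ) : dualNorm H g = matNorm H⁻¹ g := rfl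

theorem matNorm_nonneg (H : Matrix κ κ ℝ) (u : κ → ℝ) : 0 ≤ matNorm H u := Real.sqrt_nonneg _

theorem dotProduct_mulVec_comm {H : Matrix κ κ ℝ} (hH : H.IsHermitian) (u v : κ → ℝ) :
    u ⬝ᵥ (H *ᵥ v) = v ⬝ᵥ (H *ᵥ u) := by
  have h : Hᵀ = H := by simpa [Matrix.IsHermitian] using hH
  rw [dotProduct_comm, Matrix.dotProduct_mulVec, ← Matrix.mulVec_transpose, h, dotProduct_comm,
    dotProduct_comm]

theorem PosSemidef.dotProduct_nonneg {H : Matrix κ κ ℝ} (hH : H.PosSemidef) (u : κ → ℝ) :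
    0 ≤ u ⬝ᵥ (H *ᵥ u) := by
  simpa using hH.dotProduct_mulVec_nonneg u

theorem PosDef.dotProduct_pos {H : Matrix κ κ ℝ} (hH : H.PosDef) {u : κ → ℝ} (hu : u ≠ 0) :
    0 < u ⬝ᵥ (H *ᵥ u) := by
  simpa using hH.dotProduct_mulVec_pos hu

theorem matNorm_sq {H : Matrix κ κ ℝ} (hH : H.PosSemidef) (u : κ → ℝ) :
    matNorm H u ^ 2 = u ⬝ᵥ (H *ᵥ u) :=
  Real.sq_sqrt (PosSemidef.dotProduct_nonneg hH u)

theorem matNorm_pos {H : Matrix κ κ ℝ} (hH : H.PosDef) {u : κ → ℝ} (hu : u ≠ 0) :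
    0 < matNorm H u := Real.sqrt_pos.2 (PosDef.dotProduct_pos hH hu)

@[simp] theorem matNorm_zero (H : Matrix κ κ ℝ) : matNorm H 0 = 0 := by simp [matNorm]

theorem eq_zero_of_matNorm_eq_zero {H : Matrix κ κ ℝ} (hH : H.PosDef) {u : κ → ℝ}
    (h : matNorm H u = 0) : u = 0 := by
  by_contra hu
  exact (matNorm_pos hH hu).ne' h

theorem matNorm_smul (H : Matrix κ κ ℝ) (s : ℝ) (u : κ → ℝ) :
    matNorm H (s • u) = |s| * matNorm H u := by
  unfold matNorm
  rw [Matrix.mulVec_smul, dotProduct_smul, smul_dotProduct, smul_eq_mul, smul_eq_mul, ← mul_assoc,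
    Real.sqrt_mul (mul_self_nonneg s), Real.sqrt_mul_self_eq_abs]

theorem matNorm_neg (H : Matrix κ κ ℝ) (u : κ → ℝ) : matNorm H (-u) = matNorm H u := by
  simpa using matNorm_smul H (-1) u

/-- A symmetric form bounded on the diagonal by a positive definite form is bounded by it
everywhere. -/
theorem abs_dotProduct_le_of_diag {Q B : Matrix κ κ ℝ} (hQ : Q.IsHermitian) (hB : B.PosDef)
    {k : ℝ} (h : ∀ u : κ → ℝ, |u ⬝ᵥ (Q *ᵥ u)| ≤ k * (u ⬝ᵥ (B *ᵥ u))) (u v : κ → ℝ) :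
    |u ⬝ᵥ (Q *ᵥ v)| ≤ k * (matNorm B u * matNorm B v) := by
  rcases eq_or_ne u 0 with rfl | hu
  · simp
  rcases eq_or_ne v 0 with rfl | hv
  · simp
  have hp := matNorm_pos hB hu
  have hq := matNorm_pos hB hv
  have hp2 := matNorm_sq hB.posSemidef u
  have hq2 := matNorm_sq hB.posSemidef v
  set p := matNorm B u
  set q := matNorm B v
  -- Polarization with weights that equalize the two norms: the `Q`-forms differ by `4pq uᵀQv`, and
  -- the `B`-forms add up to `4p²q²`.
  have e1 := h (q • u + p • v)
  have e2 := h (q • u - p • v)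
  have hs := dotProduct_mulVec_comm hQ u v
  have hb := dotProduct_mulVec_comm hB.isHermitian u v
  simp only [Matrix.mulVec_add, Matrix.mulVec_sub, Matrix.mulVec_smul, dotProduct_add,
    add_dotProduct, sub_dotProduct, dotProduct_sub, dotProduct_smul, smul_dotProduct,
    smul_eq_mul, ← hs, ← hb, ← hp2, ← hq2] at e1 e2
  rw [abs_le] at e1 e2 ⊢
  have hpq : 0 < p * q := mul_pos hp hq
  constructor
  · refine le_of_mul_le_mul_left ?_ hpq
    linarith
  · refine le_of_mul_le_mul_left ?_ hpq
    linarith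

theorem abs_dotProduct_mulVec_le {B : Matrix κ κ ℝ} (hB : B.PosDef) (u v : κ → ℝ) :
    |u ⬝ᵥ (B *ᵥ v)| ≤ matNorm B u * matNorm B v := by
  simpa using abs_dotProduct_le_of_diag (k := 1) hB.isHermitian hB (fun u => by
    rw [one_mul, abs_of_nonneg (PosSemidef.dotProduct_nonneg hB.posSemidef u)]) u v

theorem matNorm_add_le {B : Matrix κ κ ℝ} (hB : B.PosDef) (u v : κ → ℝ) :
    matNorm B (u + v) ≤ matNorm B u + matNorm B v := by
  refine abs_le_of_sq_le_sq' ?_ (add_nonneg (matNorm_nonneg _ _) (matNorm_nonneg _ _)) |>.2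
  have h := (abs_le.1 (abs_dotProduct_mulVec_le hB u v)).2
  rw [matNorm_sq hB.posSemidef, add_sq, matNorm_sq hB.posSemidef, matNorm_sq hB.posSemidef]
  simp only [Matrix.mulVec_add, dotProduct_add, add_dotProduct]
  have hb := dotProduct_mulVec_comm hB.isHermitian u v
  linarith

theorem PosDef.isUnit_det {H : Matrix κ κ ℝ} (hH : H.PosDef) : IsUnit H.det :=
  (Matrix.isUnit_iff_isUnit_det H).1 hH.isUnit

theorem PosDef.mulVec_inv_mulVec {H : Matrix κ κ ℝ} (hH : H.PosDef) (u : κ → ℝ) :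
    H *ᵥ (H⁻¹ *ᵥ u) = u := by
  rw [Matrix.mulVec_mulVec, Matrix.mul_nonsing_inv _ (PosDef.isUnit_det hH), Matrix.one_mulVec]

theorem PosDef.inv_mulVec_mulVec {H : Matrix κ κ ℝ} (hH : H.PosDef) (u : κ → ℝ) :
    H⁻¹ *ᵥ (H *ᵥ u) = u := by
  rw [Matrix.mulVec_mulVec, Matrix.nonsing_inv_mul _ (PosDef.isUnit_det hH), Matrix.one_mulVec]

theorem matNorm_inv_mulVec {H : Matrix κ κ ℝ} (hH : H.PosDef) (u : κ → ℝ) :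
    matNorm H⁻¹ (H *ᵥ u) = matNorm H u := by
  unfold matNorm
  rw [PosDef.inv_mulVec_mulVec hH, dotProduct_comm]

theorem matNorm_mulVec_inv {H : Matrix κ κ ℝ} (hH : H.PosDef) (u : κ → ℝ) :
    matNorm H (H⁻¹ *ᵥ u) = matNorm H⁻¹ u := by
  rw [← matNorm_inv_mulVec hH, PosDef.mulVec_inv_mulVec hH]

theorem abs_dotProduct_le_dual {H : Matrix κ κ ℝ} (hH : H.PosDef) (u v : κ → ℝ) :
    |u ⬝ᵥ v| ≤ matNorm H⁻¹ u * matNorm H v := by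
  have h := abs_dotProduct_mulVec_le hH v (H⁻¹ *ᵥ u)
  rwa [PosDef.mulVec_inv_mulVec hH, matNorm_mulVec_inv hH, dotProduct_comm, mul_comm] at h

/-- The norm of a vector is attained on the dual ball. -/
theorem matNorm_le_of_forall_dual {H : Matrix κ κ ℝ} (hH : H.PosDef) {w : κ → ℝ} {C : ℝ} (hC : 0 ≤ C)
    (h : ∀ z : κ → ℝ, z ⬝ᵥ w ≤ C * matNorm H⁻¹ z) : matNorm H w ≤ C := by
  rcases eq_or_ne w 0 with rfl | hw
  · rwa [matNorm_zero]
  · have h1 := h (H *ᵥ w)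
    rw [matNorm_inv_mulVec hH, dotProduct_comm, ← matNorm_sq hH.posSemidef, sq] at h1
    exact le_of_mul_le_mul_right h1 (matNorm_pos hH hw)

/-- Inversion reverses the comparison of the norms of positive definite matrices. -/
theorem matNorm_inv_le {H K : Matrix κ κ ℝ} (hH : H.PosDef) (hK : K.PosDef) {k : ℝ}
    (h : ∀ u, matNorm K u ≤ k * matNorm H u) (v : κ → ℝ) :
    matNorm H⁻¹ v ≤ k * matNorm K⁻¹ v := by
  rcases eq_or_ne v 0 with rfl | hv
  · simp
  have hp := matNorm_pos hH.inv hv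
  have h1 := (abs_le.1 (abs_dotProduct_le_dual hK v (H⁻¹ *ᵥ v))).2
  have h2 := h (H⁻¹ *ᵥ v)
  rw [matNorm_mulVec_inv hH] at h2
  rw [← matNorm_sq hH.inv.posSemidef] at h1
  refine le_of_mul_le_mul_right ?_ hp
  nlinarith [mul_le_mul_of_nonneg_left h2 (matNorm_nonneg K⁻¹ v)]

/-- If `s² H ≤ K ≤ s⁻² H` then `‖(H⁻¹ - K⁻¹) v‖_H ≤ (s⁻² - 1) ‖v‖_{H⁻¹}`. -/
theorem matNorm_inv_sub_inv_le {H K : Matrix κ κ ℝ} (hH : H.PosDef) (hK : K.PosDef) {s : ℝ}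
    (hs : 0 < s) (hs1 : s ≤ 1) (h1 : ∀ u, matNorm K u ≤ s⁻¹ * matNorm H u)
    (h2 : ∀ u, matNorm H u ≤ s⁻¹ * matNorm K u) (v : κ → ℝ) :
    matNorm H ((H⁻¹ - K⁻¹) *ᵥ v) ≤ ((s ^ 2)⁻¹ - 1) * matNorm H⁻¹ v := by
  have hsi : 1 ≤ s⁻¹ := (one_le_inv₀ hs).2 hs1
  have hk0 : 0 ≤ (s ^ 2)⁻¹ - 1 := by
    rw [← inv_pow]; nlinarith
  have hherm : (H⁻¹ - K⁻¹).IsHermitian := hH.inv.isHermitian.sub hK.inv.isHermitian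
  have hdiag : ∀ u : κ → ℝ,
      |u ⬝ᵥ ((H⁻¹ - K⁻¹) *ᵥ u)| ≤ ((s ^ 2)⁻¹ - 1) * (u ⬝ᵥ (H⁻¹ *ᵥ u)) := by
    intro u
    have a1 := matNorm_inv_le hH hK h1 u
    have a2 := matNorm_inv_le hK hH h2 u
    rw [Matrix.sub_mulVec, dotProduct_sub, ← matNorm_sq hH.inv.posSemidef,
      ← matNorm_sq hK.inv.posSemidef]
    have b0 := matNorm_nonneg H⁻¹ u
    have b1 := matNorm_nonneg K⁻¹ u
    set p := matNorm H⁻¹ u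
    set q := matNorm K⁻¹ u
    have hq : q ^ 2 ≤ (s ^ 2)⁻¹ * p ^ 2 := by
      rw [← inv_pow, ← mul_pow]; exact pow_le_pow_left₀ b1 a2 2
    have hp : s ^ 2 * p ^ 2 ≤ q ^ 2 := by
      rw [← mul_pow]
      refine pow_le_pow_left₀ (by positivity) ?_ 2
      calc s * p ≤ s * (s⁻¹ * q) := by gcongr
        _ = q := by field_simp
    -- The lower deviation `1 - s²` is the smaller one because `s² + s⁻² ≥ 2`.
    have hr : 1 - s ^ 2 ≤ (s ^ 2)⁻¹ - 1 := by
      have h3 : (s ^ 2) * (s ^ 2)⁻¹ = 1 := mul_inv_cancel₀ (by positivity)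
      nlinarith [sq_nonneg (s⁻¹ - s), inv_pow s 2, mul_inv_cancel₀ hs.ne']
    rw [abs_le]
    constructor
    · linarith
    · nlinarith [mul_le_mul_of_nonneg_right hr (sq_nonneg p)]
  refine matNorm_le_of_forall_dual hH (mul_nonneg hk0 (matNorm_nonneg _ _)) fun z => ?_
  have h3 := (abs_le.1 (abs_dotProduct_le_of_diag hherm hH.inv hdiag z v)).2
  linarith

/-! ### The Schur complement `A H⁻¹ Aᵀ`. -/

section Projection

variable {A : Matrix ι κ ℝ}

theorem PosDef.mul_inv_mul_transpose {H : Matrix κ κ ℝ} (hH : H.PosDef)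
    (hA : A.rank = Fintype.card ι) : (A * H⁻¹ * Aᵀ).PosDef := by
  have hinj : Function.Injective A.vecMul := by
    rw [Matrix.vecMul_injective_iff, linearIndependent_iff_card_eq_finrank_span, ← hA,
      Matrix.rank_eq_finrank_span_row]
    rfl
  simpa using hH.inv.mul_mul_conjTranspose_same hinj

theorem matNorm_transpose_mulVec (H : Matrix κ κ ℝ) (q : ι → ℝ) :
    matNorm H (Aᵀ *ᵥ q) = matNorm (A * H * Aᵀ) q := by
  unfold matNorm
  congr 1
  rw [Matrix.mulVec_transpose, ← Matrix.dotProduct_mulVec, ← Matrix.mulVec_transpose,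
    Matrix.mulVec_mulVec, Matrix.mulVec_mulVec, Matrix.mul_assoc]

/-- Pairing `z` with `Aᵀ S⁻¹ A z` gives the square of the left side, and the dual norm of that
vector is again the left side; Cauchy–Schwarz concludes. Geometrically, the left side is the least
`H`-norm among the vectors with the same image as `z`. -/
theorem dualNorm_mulVec_le {H : Matrix κ κ ℝ} (hH : H.PosDef)
    (hA : A.rank = Fintype.card ι) (z : κ → ℝ) :
    dualNorm (A * H⁻¹ * Aᵀ) (A *ᵥ z) ≤ matNorm H z := by
  have hS := PosDef.mul_inv_mul_transpose hH hA
  set S := A * H⁻¹ * Aᵀ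
  rw [dualNorm_eq_matNorm]
  rcases eq_or_ne (A *ᵥ z) 0 with h0 | h0
  · rw [h0, matNorm_zero]; exact matNorm_nonneg _ _
  have hp := matNorm_pos hS.inv h0
  have h1 := (abs_le.1 (abs_dotProduct_le_dual hH (Aᵀ *ᵥ (S⁻¹ *ᵥ (A *ᵥ z))) z)).2
  rw [matNorm_transpose_mulVec, matNorm_mulVec_inv hS, Matrix.mulVec_transpose,
    ← Matrix.dotProduct_mulVec, dotProduct_comm, ← matNorm_sq hS.inv.posSemidef, sq] at h1
  exact le_of_mul_le_mul_left h1 hp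

/-- The preimage `z = H⁻¹AᵀS⁻¹g` of `g` attains equality in `dualNorm_mulVec_le` for `H`; it is then
used as a competitor for `K`. -/
theorem dualNorm_le_of_matNorm_le {H K : Matrix κ κ ℝ} (hH : H.PosDef) (hK : K.PosDef)
    (hA : A.rank = Fintype.card ι) {k : ℝ} (h : ∀ u, matNorm K u ≤ k * matNorm H u) (g : ι → ℝ) :
    dualNorm (A * K⁻¹ * Aᵀ) g ≤ k * dualNorm (A * H⁻¹ * Aᵀ) g := by
  have hS := PosDef.mul_inv_mul_transpose hH hA
  set z := H⁻¹ *ᵥ (Aᵀ *ᵥ ((A * H⁻¹ * Aᵀ)⁻¹ *ᵥ g)) with hz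
  have hAz : A *ᵥ z = g := by
    rw [hz, Matrix.mulVec_mulVec, Matrix.mulVec_mulVec, PosDef.mulVec_inv_mulVec hS]
  have hnz : matNorm H z = dualNorm (A * H⁻¹ * Aᵀ) g := by
    rw [hz, matNorm_mulVec_inv hH, matNorm_transpose_mulVec, matNorm_mulVec_inv hS]
    rfl
  calc dualNorm (A * K⁻¹ * Aᵀ) g = dualNorm (A * K⁻¹ * Aᵀ) (A *ᵥ z) := by rw [hAz]
    _ ≤ matNorm K z := dualNorm_mulVec_le hK hA z
    _ ≤ k * matNorm H z := h z
    _ = _ := by rw [hnz]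

end Projection

end LinearAlgebra

/-! ### Polarization of symmetric trilinear forms without loss of constant. -/

section Trilinear

/-- The value `T(h,u,u)` of a symmetric trilinear form on the plane, `h` being at angle `3α` from
`u`, as a combination with signed weights of total mass one of the values `T(x,x,x)` at the unit
vectors at the angles `α`, `α + π/3`, `α + 2π/3`. Here `a = cos α`, `b = sin α`, `q = √3`. -/
theorem cubic_interpolation (a b q t1 t2 t3 t4 : ℝ) (h : a ^ 2 + b ^ 2 = 1) (hq : q ^ 2 = 3) :
    (4 * a ^ 3 - 3 * a) * t1 + (3 * b - 4 * b ^ 3) * t2 =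
      ((3 * a ^ 2 - b ^ 2) / 3) ^ 2 *
        (a ^ 3 * t1 + 3 * a ^ 2 * b * t2 + 3 * a * b ^ 2 * t3 + b ^ 3 * t4)
      - ((2 * b ^ 2 - 2 * q * a * b) / 3) ^ 2 *
        (((a - q * b) / 2) ^ 3 * t1 + 3 * ((a - q * b) / 2) ^ 2 * ((b + q * a) / 2) * t2
          + 3 * ((a - q * b) / 2) * ((b + q * a) / 2) ^ 2 * t3 + ((b + q * a) / 2) ^ 3 * t4)
      + ((2 * b ^ 2 + 2 * q * a * b) / 3) ^ 2 *
        (((-a - q * b) / 2) ^ 3 * t1 + 3 * ((-a - q * b) / 2) ^ 2 * ((-b + q * a) / 2) * t2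
          + 3 * ((-a - q * b) / 2) * ((-b + q * a) / 2) ^ 2 * t3
          + ((-b + q * a) / 2) ^ 3 * t4) := by
  grind

theorem cubic_interpolation_weights (a b q : ℝ) (h : a ^ 2 + b ^ 2 = 1) (hq : q ^ 2 = 3) :
    ((3 * a ^ 2 - b ^ 2) / 3) ^ 2 + ((2 * b ^ 2 - 2 * q * a * b) / 3) ^ 2
      + ((2 * b ^ 2 + 2 * q * a * b) / 3) ^ 2 = 1 := by
  grind

/-- A binary cubic form bounded by `C` on the unit circle has `|T(h,u,u)| ≤ C` for unit vectors. -/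
theorem abs_cubic_polar_le {t1 t2 t3 t4 C : ℝ}
    (hC : ∀ x y : ℝ, x ^ 2 + y ^ 2 = 1 →
      |x ^ 3 * t1 + 3 * x ^ 2 * y * t2 + 3 * x * y ^ 2 * t3 + y ^ 3 * t4| ≤ C) (φ : ℝ) :
    |Real.cos φ * t1 + Real.sin φ * t2| ≤ C := by
  have hφ : φ = 3 * (φ / 3) := by ring
  have hab : Real.cos (φ / 3) ^ 2 + Real.sin (φ / 3) ^ 2 = 1 := Real.cos_sq_add_sin_sq _
  rw [hφ, Real.cos_three_mul, Real.sin_three_mul]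
  set a := Real.cos (φ / 3)
  set b := Real.sin (φ / 3)
  have hq : Real.sqrt 3 ^ 2 = 3 := Real.sq_sqrt (by norm_num)
  set q := Real.sqrt 3
  rw [cubic_interpolation a b q t1 t2 t3 t4 hab hq]
  have hw := cubic_interpolation_weights a b q hab hq
  have h0 := hC a b hab
  -- The unit vectors at the angles `α + π/3` and `α + 2π/3`, where `3α = φ`.
  have h1 := hC ((a - q * b) / 2) ((b + q * a) / 2) (by grind)
  have h2 := hC ((-a - q * b) / 2) ((-b + q * a) / 2) (by grind)
  have s0 := sq_nonneg ((3 * a ^ 2 - b ^ 2) / 3)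
  have s1 := sq_nonneg ((2 * b ^ 2 - 2 * q * a * b) / 3)
  have s2 := sq_nonneg ((2 * b ^ 2 + 2 * q * a * b) / 3)
  generalize ((3 * a ^ 2 - b ^ 2) / 3) ^ 2 = w0 at *
  generalize ((2 * b ^ 2 - 2 * q * a * b) / 3) ^ 2 = w1 at *
  generalize ((2 * b ^ 2 + 2 * q * a * b) / 3) ^ 2 = w2 at *
  generalize a ^ 3 * t1 + 3 * a ^ 2 * b * t2 + 3 * a * b ^ 2 * t3 + b ^ 3 * t4 = v0 at *
  generalize ((a - q * b) / 2) ^ 3 * t1 + 3 * ((a - q * b) / 2) ^ 2 * ((b + q * a) / 2) * t2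
          + 3 * ((a - q * b) / 2) * ((b + q * a) / 2) ^ 2 * t3 + ((b + q * a) / 2) ^ 3 * t4
          = v1 at *
  generalize ((-a - q * b) / 2) ^ 3 * t1 + 3 * ((-a - q * b) / 2) ^ 2 * ((-b + q * a) / 2) * t2
          + 3 * ((-a - q * b) / 2) * ((-b + q * a) / 2) ^ 2 * t3
          + ((-b + q * a) / 2) ^ 3 * t4 = v2 at *
  rw [abs_le] at h0 h1 h2 ⊢
  constructor
  · nlinarith [mul_le_mul_of_nonneg_left h0.1 s0, mul_le_mul_of_nonneg_left h1.2 s1,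
      mul_le_mul_of_nonneg_left h2.1 s2]
  · nlinarith [mul_le_mul_of_nonneg_left h0.2 s0, mul_le_mul_of_nonneg_left h1.1 s1,
      mul_le_mul_of_nonneg_left h2.2 s2]

variable {κ : Type*} [Fintype κ] [DecidableEq κ]

/-- A symmetric trilinear form bounded on the diagonal by the cube of a Euclidean norm satisfies
`|T(h,u,u)| ≤ C ‖h‖ ‖u‖²` with the same constant. -/
theorem abs_trilinear_le {B : Matrix κ κ ℝ} (hB : B.PosDef)
    (T : (κ → ℝ) →L[ℝ] (κ → ℝ) →L[ℝ] (κ → ℝ) →L[ℝ] ℝ)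
    (h12 : ∀ a b c, T a b c = T b a c) (h23 : ∀ a b c, T a b c = T a c b)
    {C : ℝ} (hC : 0 ≤ C) (hT : ∀ u, |T u u u| ≤ C * matNorm B u ^ 3) (h u : κ → ℝ) :
    |T h u u| ≤ C * (matNorm B h * matNorm B u ^ 2) := by
  rcases eq_or_ne u 0 with rfl | hu
  · simp
  rcases eq_or_ne h 0 with rfl | hh
  · simp
  have hnu := matNorm_pos hB hu
  have hnh := matNorm_pos hB hh
  set p := matNorm B u with hp
  set r := matNorm B h with hr
  set u0 := p⁻¹ • u with hu0
  set h0 := r⁻¹ • h with hh0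
  have hu1 : matNorm B u0 = 1 := by
    rw [hu0, matNorm_smul, abs_of_pos (inv_pos.2 hnu), ← hp, inv_mul_cancel₀ hnu.ne']
  have hh1 : matNorm B h0 = 1 := by
    rw [hh0, matNorm_smul, abs_of_pos (inv_pos.2 hnh), ← hr, inv_mul_cancel₀ hnh.ne']
  have hu2 : u0 ⬝ᵥ (B *ᵥ u0) = 1 := by rw [← matNorm_sq hB.posSemidef, hu1, one_pow]
  have hh2 : h0 ⬝ᵥ (B *ᵥ h0) = 1 := by rw [← matNorm_sq hB.posSemidef, hh1, one_pow]
  set c := h0 ⬝ᵥ (B *ᵥ u0) with hc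
  have hcs : u0 ⬝ᵥ (B *ᵥ h0) = c := dotProduct_mulVec_comm hB.isHermitian _ _
  have hcabs : |c| ≤ 1 := by
    have := abs_dotProduct_mulVec_le hB h0 u0
    rwa [hu1, hh1, mul_one] at this
  have hc1 := abs_le.1 hcabs
  have hsin : Real.sin (Real.arccos c) = Real.sqrt (1 - c ^ 2) := Real.sin_arccos c
  have hcos : Real.cos (Real.arccos c) = c := Real.cos_arccos hc1.1 hc1.2
  set d := Real.sqrt (1 - c ^ 2) with hd
  have hd2 : d ^ 2 = 1 - c ^ 2 := Real.sq_sqrt (by nlinarith)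
  -- Gram–Schmidt in the plane of `h` and `u`: `h0 = cos φ · u0 + sin φ · e` with `φ = arccos c`.
  set w := h0 - c • u0 with hw
  have hw2 : w ⬝ᵥ (B *ᵥ w) = d ^ 2 := by
    rw [hw]
    simp only [Matrix.mulVec_sub, Matrix.mulVec_smul, sub_dotProduct, dotProduct_sub,
      dotProduct_smul, smul_dotProduct, smul_eq_mul, hu2, hh2, hcs, ← hc, hd2]
    ring
  have hwu : w ⬝ᵥ (B *ᵥ u0) = 0 := by
    rw [hw]
    simp only [sub_dotProduct, smul_dotProduct, smul_eq_mul, hu2, ← hc]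
    ring
  have hdw : d • (d⁻¹ • w) = w := by
    by_cases hd0 : d = 0
    · have : w = 0 := eq_zero_of_matNorm_eq_zero hB (by
        unfold matNorm; rw [hw2, hd0]; simp)
      simp [this]
    · rw [smul_smul, mul_inv_cancel₀ hd0, one_smul]
  set e := d⁻¹ • w with he
  have heu : e ⬝ᵥ (B *ᵥ u0) = 0 := by rw [he, smul_dotProduct, hwu, smul_zero]
  have hue : u0 ⬝ᵥ (B *ᵥ e) = 0 := by rw [dotProduct_mulVec_comm hB.isHermitian, heu]
  -- Only an inequality: for parallel `h` and `u`, `d = 0`, and `d⁻¹ = 0` makes `e` vanish. The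
  -- bound on the unit circle survives since `x u0 + y e` still has norm at most one.
  have hee : e ⬝ᵥ (B *ᵥ e) ≤ 1 := by
    rw [he]
    simp only [Matrix.mulVec_smul, dotProduct_smul, smul_dotProduct, smul_eq_mul, hw2]
    by_cases hd0 : d = 0
    · simp [hd0]
    · field_simp; exact le_refl _
  have key : |Real.cos (Real.arccos c) * T u0 u0 u0 + Real.sin (Real.arccos c) * T e u0 u0|
      ≤ C := by
    refine abs_cubic_polar_le (t3 := T e e u0) (t4 := T e e e) (fun x y hxy => ?_) _
    have e1 : T (x • u0 + y • e) (x • u0 + y • e) (x • u0 + y • e)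
        = x ^ 3 * T u0 u0 u0 + 3 * x ^ 2 * y * T e u0 u0 + 3 * x * y ^ 2 * T e e u0
          + y ^ 3 * T e e e := by
      simp only [map_add, map_smul, _root_.add_apply, _root_.smul_apply,
        smul_eq_mul]
      rw [h12 u0 e u0, h23 u0 u0 e, h12 u0 e u0, h12 u0 e e, h23 e u0 e]
      ring
    rw [← e1]
    refine (hT _).trans (mul_le_of_le_one_right hC ?_)
    refine pow_le_one₀ (matNorm_nonneg _ _) ?_
    unfold matNorm
    rw [Real.sqrt_le_one]
    simp only [Matrix.mulVec_add, Matrix.mulVec_smul, dotProduct_add,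
      add_dotProduct, dotProduct_smul, smul_dotProduct, smul_eq_mul, hu2, heu, hue]
    nlinarith [mul_le_mul_of_nonneg_left hee (sq_nonneg y)]
  have hh3 : h0 = c • u0 + d • e := by rw [hdw, hw]; abel
  have h4 : T h0 u0 u0 = c * T u0 u0 u0 + d * T e u0 u0 := by
    rw [hh3]
    simp only [map_add, map_smul, _root_.add_apply, _root_.smul_apply,
      smul_eq_mul]
  rw [hsin, hcos, ← h4] at key
  have hu3 : u = p • u0 := by rw [hu0, smul_smul, mul_inv_cancel₀ hnu.ne', one_smul]
  have hh4 : h = r • h0 := by rw [hh0, smul_smul, mul_inv_cancel₀ hnh.ne', one_smul]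
  have h5 : T h u u = (r * p ^ 2) * T h0 u0 u0 := by
    rw [hh4, hu3]
    simp only [map_smul, _root_.smul_apply, smul_eq_mul]
    ring
  have hrp : 0 ≤ r * p ^ 2 := by positivity
  rw [h5, abs_mul, abs_of_nonneg hrp, mul_comm C]
  exact mul_le_mul_of_nonneg_left key hrp

end Trilinear

/-! ### First, second and third derivatives in coordinates and along curves. -/

section Derivatives

variable {κ : Type*} [Fintype κ] [DecidableEq κ]

theorem grad_dotProduct (f : (κ → ℝ) → ℝ) (x u : κ → ℝ) : grad f x ⬝ᵥ u = fderiv ℝ f x u := by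
  conv_rhs => rw [pi_eq_sum_univ' u]
  simp [grad, dotProduct, mul_comm]

theorem dotProduct_hess_mulVec (f : (κ → ℝ) → ℝ) (x u v : κ → ℝ) :
    u ⬝ᵥ (hess f x *ᵥ v) = fderiv ℝ (fderiv ℝ f) x u v := by
  conv_rhs => rw [pi_eq_sum_univ' u, pi_eq_sum_univ' v]
  simp only [map_sum, map_smul, FunLike.coe_sum, Finset.sum_apply,
    _root_.smul_apply, smul_eq_mul]
  simp only [hess, dotProduct, Matrix.mulVec, Matrix.of_apply, iteratedFDeriv_two_apply,
    Matrix.cons_val_zero, Matrix.cons_val_one, Finset.mul_sum]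
  rw [Finset.sum_comm]
  refine Finset.sum_congr rfl fun i _ => Finset.sum_congr rfl fun j _ => ?_
  ring

/-- The third derivative as a trilinear form. -/
def third (f : (κ → ℝ) → ℝ) (x : κ → ℝ) : (κ → ℝ) →L[ℝ] (κ → ℝ) →L[ℝ] (κ → ℝ) →L[ℝ] ℝ :=
  fderiv ℝ (fderiv ℝ (fderiv ℝ f)) x

variable {f : (κ → ℝ) → ℝ} {x : κ → ℝ}

theorem ContDiffAt.fderiv_one (hf : ContDiffAt ℝ 3 f x) : ContDiffAt ℝ 2 (fderiv ℝ f) x :=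
  hf.fderiv_right (by norm_num)

theorem ContDiffAt.fderiv_two (hf : ContDiffAt ℝ 3 f x) :
    ContDiffAt ℝ 1 (fderiv ℝ (fderiv ℝ f)) x :=
  (ContDiffAt.fderiv_one hf).fderiv_right (by norm_num)

theorem hasFDerivAt_fderiv_fderiv (hf : ContDiffAt ℝ 3 f x) :
    HasFDerivAt (fderiv ℝ (fderiv ℝ f)) (third f x) x :=
  ((ContDiffAt.fderiv_two hf).differentiableAt (by norm_num)).hasFDerivAt

theorem iteratedFDeriv_three_apply (f : (κ → ℝ) → ℝ) (x u v w : κ → ℝ) :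
    iteratedFDeriv ℝ 3 f x ![u, v, w] = third f x u v w := by
  rw [iteratedFDeriv_succ_apply_right, iteratedFDeriv_succ_apply_right,
    iteratedFDeriv_succ_apply_right, iteratedFDeriv_zero_apply]
  rfl

theorem hasFDerivAt_fderiv_fderiv_apply (hf : ContDiffAt ℝ 3 f x) (v w : κ → ℝ) :
    HasFDerivAt (fun z => fderiv ℝ (fderiv ℝ f) z v w) (((third f x).flip v).flip w) x := by
  have h1 := (hasFDerivAt_fderiv_fderiv hf).clm_apply (hasFDerivAt_const v x)
  have h2 := h1.clm_apply (hasFDerivAt_const w x)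
  refine h2.congr_fderiv ?_
  ext u
  simp

theorem third_swap_right (hf : ContDiffAt ℝ 3 f x) (u v w : κ → ℝ) :
    third f x u v w = third f x u w v := by
  have e := fun v w => hasFDerivAt_fderiv_fderiv_apply hf v w
  have h3 : (fun z => fderiv ℝ (fderiv ℝ f) z v w) =ᶠ[nhds x]
      fun z => fderiv ℝ (fderiv ℝ f) z w v := by
    filter_upwards [hf.eventually (by norm_num)] with z hz
    exact hz.isSymmSndFDerivAt (by simp; norm_num) v w
  have h4 := ((e v w).congr_of_eventuallyEq h3.symm).unique (e w v)
  simpa using congrArg (fun L => L u) h4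

theorem third_swap_left (hf : ContDiffAt ℝ 3 f x) (u v w : κ → ℝ) :
    third f x u v w = third f x v u w := by
  have h := (ContDiffAt.fderiv_one hf).isSymmSndFDerivAt (by simp) u v
  exact congrArg (fun L => L w) h

theorem hess_isHermitian (hf : ContDiffAt ℝ 3 f x) : (hess f x).IsHermitian := by
  ext i j
  simp only [hess, Matrix.conjTranspose_apply, Matrix.of_apply, iteratedFDeriv_two_apply,
    star_trivial, Matrix.cons_val_zero, Matrix.cons_val_one]
  exact hf.isSymmSndFDerivAt (by simp; norm_num) _ _

theorem hasDerivAt_hess_along (u v : κ → ℝ) {z : ℝ → κ → ℝ} {z' : κ → ℝ} {s : ℝ}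
    (hf : ContDiffAt ℝ 3 f (z s)) (hz : HasDerivAt z z' s) :
    HasDerivAt (fun s => u ⬝ᵥ (hess f (z s) *ᵥ v)) (third f (z s) z' u v) s := by
  simp only [dotProduct_hess_mulVec]
  exact (hasFDerivAt_fderiv_fderiv_apply hf u v).comp_hasDerivAt s hz

theorem hasDerivAt_fderiv_along (u : κ → ℝ) {z : ℝ → κ → ℝ} {z' : κ → ℝ} {s : ℝ}
    (hf : ContDiffAt ℝ 3 f (z s)) (hz : HasDerivAt z z' s) :
    HasDerivAt (fun s => fderiv ℝ f (z s) u) (z' ⬝ᵥ (hess f (z s) *ᵥ u)) s := by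
  rw [dotProduct_hess_mulVec]
  have h0 : HasFDerivAt (fderiv ℝ f) (fderiv ℝ (fderiv ℝ f) (z s)) (z s) :=
    ((ContDiffAt.fderiv_one hf).differentiableAt (by norm_num)).hasFDerivAt
  have h1 := h0.comp_hasDerivAt s hz
  simpa using h1.clm_apply (hasDerivAt_const s u)

theorem hasDerivAt_along {z : ℝ → κ → ℝ} {z' : κ → ℝ} {s : ℝ}
    (hf : ContDiffAt ℝ 3 f (z s)) (hz : HasDerivAt z z' s) :
    HasDerivAt (fun s => f (z s)) (fderiv ℝ f (z s) z') s :=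
  (hf.differentiableAt (by norm_num)).hasFDerivAt.comp_hasDerivAt s hz

theorem hasDerivAt_line (x h : κ → ℝ) (s : ℝ) : HasDerivAt (fun s : ℝ => x + s • h) h s := by
  simpa using ((hasDerivAt_id s).smul_const h).const_add x

variable {D : Set (κ → ℝ)}

namespace IsSelfConcordant

theorem contDiffAt (hf : IsSelfConcordant D f) (hx : x ∈ D) : ContDiffAt ℝ 3 f x :=
  hf.contDiffOn.contDiffAt (hf.isOpen.mem_nhds hx)

theorem abs_third_le (hf : IsSelfConcordant D f) (hx : x ∈ D) (u : κ → ℝ) :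
    |third f x u u u| ≤ 2 * matNorm (hess f x) u ^ 3 := by
  rw [← iteratedFDeriv_three_apply]
  exact hf.third_le x hx u

theorem hess_posSemidef (hf : IsSelfConcordant D f) (hx : x ∈ D) : (hess f x).PosSemidef := by
  refine Matrix.PosSemidef.of_dotProduct_mulVec_nonneg (hess_isHermitian (hf.contDiffAt hx))
    fun u => ?_
  rw [star_trivial]
  set S : Set ℝ := (fun s : ℝ => x + s • u) ⁻¹' D with hS
  have hSo : IsOpen S := hf.isOpen.preimage (by fun_prop)
  have h0 : (0 : ℝ) ∈ S := by simpa [hS] using hx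
  have hconv : ConvexOn ℝ S (fun s : ℝ => f (x + s • u)) := by
    have := hf.convexOn.comp_affineMap (AffineMap.lineMap x (x + u))
    have e : ⇑(AffineMap.lineMap x (x + u)) = fun s : ℝ => x + s • u := by
      ext s; simp [AffineMap.lineMap_apply, add_comm]
    rwa [e] at this
  have hd : ∀ s ∈ S, HasDerivAt (fun s : ℝ => f (x + s • u)) (fderiv ℝ f (x + s • u) u) s :=
    fun s hs => hasDerivAt_along (hf.contDiffAt hs) (hasDerivAt_line x u s)
  -- On a line the derivative of a convex function is monotone, so its own derivative, the Hessian
  -- form, is nonnegative.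
  have hm := hconv.monotoneOn_derivWithin
    (fun s hs => (hd s hs).differentiableAt.differentiableWithinAt)
  have hm' : MonotoneOn (fun s : ℝ => fderiv ℝ f (x + s • u) u) S := by
    refine hm.congr fun s hs => ?_
    rw [derivWithin_of_isOpen hSo hs, (hd s hs).deriv]
  have h2 := hm'.derivWithin_nonneg (x := 0)
  rw [derivWithin_of_isOpen hSo h0, (hasDerivAt_fderiv_along u (z := fun s : ℝ => x + s • u)
    (hf.contDiffAt h0) (hasDerivAt_line x u 0)).deriv] at h2
  simpa using h2

end IsSelfConcordant

end Derivatives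

/-! ### Scalar differential inequalities. -/

section Comparison

open Filter Topology Set

/-- If `φ ≥ 0` and `φ' ≤ 2 φ^{3/2}` then `φ^{1/2}` grows at most like a solution of `ρ' = ρ²`. -/
theorem sqrt_mul_one_sub_le {φ φ' : ℝ → ℝ} {T : ℝ} (hT : 0 ≤ T)
    (hd : ∀ s ∈ Icc 0 T, HasDerivAt φ (φ' s) s) (h0 : ∀ s ∈ Icc 0 T, 0 ≤ φ s)
    (h : ∀ s ∈ Icc 0 T, φ' s ≤ 2 * Real.sqrt (φ s) ^ 3) :
    Real.sqrt (φ T) * (1 - T * Real.sqrt (φ 0)) ≤ Real.sqrt (φ 0) := by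
  -- Since `φ` may vanish, `φ^{-1/2}` is replaced by `(φ + ε)^{-1/2}`, whose sum with `s` is
  -- nondecreasing; then `ε → 0`.
  have key : ∀ ε : ℝ, 0 < ε →
      Real.sqrt (φ T + ε) * (1 - T * Real.sqrt (φ 0 + ε)) ≤ Real.sqrt (φ 0 + ε) := by
    intro ε hε
    have hp : ∀ s ∈ Icc 0 T, 0 < φ s + ε := fun s hs => add_pos_of_nonneg_of_pos (h0 s hs) hε
    have hder : ∀ s ∈ Icc 0 T, HasDerivAt (fun s => (Real.sqrt (φ s + ε))⁻¹ + s)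
        (-(φ' s / (2 * Real.sqrt (φ s + ε))) / Real.sqrt (φ s + ε) ^ 2 + 1) s := fun s hs =>
      ((((hd s hs).add_const ε).sqrt (hp s hs).ne').inv (Real.sqrt_pos.2 (hp s hs)).ne').add
        (hasDerivAt_id s)
    have hmono : MonotoneOn (fun s => (Real.sqrt (φ s + ε))⁻¹ + s) (Icc 0 T) := by
      refine monotoneOn_of_hasDerivWithinAt_nonneg (convex_Icc _ _)
        (fun s hs => (hder s hs).continuousAt.continuousWithinAt)
        (fun s hs => (hder s (interior_subset hs)).hasDerivWithinAt) (fun s hs => ?_)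
      have hs' := interior_subset hs
      have hq := Real.sqrt_pos.2 (hp s hs')
      have hle : Real.sqrt (φ s) ≤ Real.sqrt (φ s + ε) := Real.sqrt_le_sqrt (by linarith)
      have h1 : φ' s ≤ 2 * Real.sqrt (φ s + ε) ^ 3 := (h s hs').trans (by gcongr)
      set q := Real.sqrt (φ s + ε)
      have : -(φ' s / (2 * q)) / q ^ 2 + 1 = (2 * q ^ 3 - φ' s) / (2 * q ^ 3) := by
        field_simp; ring
      rw [this]
      exact div_nonneg (by linarith) (by positivity)
    have h1 := hmono (left_mem_Icc.2 hT) (right_mem_Icc.2 hT) hT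
    have ha := Real.sqrt_pos.2 (hp 0 (left_mem_Icc.2 hT))
    have hb := Real.sqrt_pos.2 (hp T (right_mem_Icc.2 hT))
    simp only [add_zero] at h1
    set a := Real.sqrt (φ 0 + ε)
    set b := Real.sqrt (φ T + ε)
    have h2 := mul_le_mul_of_nonneg_left h1 (mul_pos ha hb).le
    have e1 : a * b * a⁻¹ = b := by field_simp
    have e2 : a * b * (b⁻¹ + T) = a + T * a * b := by field_simp
    rw [e1, e2] at h2
    linarith
  have hc : ∀ c : ℝ, Tendsto (fun ε => Real.sqrt (c + ε)) (𝓝[>] 0) (𝓝 (Real.sqrt c)) := by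
    intro c
    have : ContinuousAt (fun ε => Real.sqrt (c + ε)) 0 := by fun_prop
    simpa [ContinuousAt] using this.tendsto.mono_left (nhdsWithin_le_nhds (s := Ioi 0))
  exact le_of_tendsto_of_tendsto ((hc _).mul ((hc (φ 0)).const_mul T |>.const_sub 1)) (hc (φ 0))
    (eventually_nhdsWithin_of_forall key)

/-- Comparison for `|ψ'| ≤ 2 r / (1 - s r) ψ`. -/
theorem comparison_of_abs_deriv_le {ψ ψ' : ℝ → ℝ} {r : ℝ} (hr0 : 0 ≤ r) (hr : r < 1)
    (hd : ∀ s ∈ Icc (0 : ℝ) 1, HasDerivAt ψ (ψ' s) s)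
    (h : ∀ s ∈ Icc (0 : ℝ) 1, |ψ' s| ≤ 2 * (r / (1 - s * r)) * ψ s) {a : ℝ}
    (ha : a ∈ Icc (0 : ℝ) 1) :
    (1 - r) ^ 2 * ψ 1 ≤ (1 - a * r) ^ 2 * ψ a ∧ (1 - a * r) ^ 2 * ψ 0 ≤ ψ a := by
  have hp : ∀ s ∈ Icc (0 : ℝ) 1, 0 < 1 - s * r := fun s hs => by
    nlinarith [mul_le_mul_of_nonneg_right hs.2 hr0]
  have hl : ∀ s, HasDerivAt (fun s : ℝ => 1 - s * r) (-r) s := fun s => by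
    simpa using ((hasDerivAt_id s).mul_const r).const_sub 1
  constructor
  · have hder : ∀ s ∈ Icc (0 : ℝ) 1, HasDerivAt (fun s => (1 - s * r) ^ 2 * ψ s)
        ((2 * (1 - s * r) * -r) * ψ s + (1 - s * r) ^ 2 * ψ' s) s := fun s hs => by
      simpa using ((hl s).fun_pow 2).fun_mul (hd s hs)
    have hanti : AntitoneOn (fun s => (1 - s * r) ^ 2 * ψ s) (Icc 0 1) := by
      refine antitoneOn_of_hasDerivWithinAt_nonpos (convex_Icc _ _)
        (fun s hs => (hder s hs).continuousAt.continuousWithinAt)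
        (fun s hs => (hder s (interior_subset hs)).hasDerivWithinAt) (fun s hs => ?_)
      have hs' := interior_subset hs
      have h1 := (abs_le.1 (h s hs')).2
      have h2 := mul_le_mul_of_nonneg_left h1 (sq_nonneg (1 - s * r))
      have h3 : (1 - s * r) ^ 2 * (2 * (r / (1 - s * r)) * ψ s)
          = 2 * (1 - s * r) * r * ψ s := by
        have := (hp s hs').ne'
        field_simp
      linarith
    have := hanti ha (right_mem_Icc.2 zero_le_one) ha.2
    simpa using this
  · have hder : ∀ s ∈ Icc (0 : ℝ) 1, HasDerivAt (fun s => ψ s / (1 - s * r) ^ 2)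
        ((ψ' s * (1 - s * r) ^ 2 - ψ s * (2 * (1 - s * r) * -r)) / ((1 - s * r) ^ 2) ^ 2) s :=
      fun s hs => by
        simpa using (hd s hs).fun_div ((hl s).fun_pow 2) (pow_ne_zero 2 (hp s hs).ne')
    have hmono : MonotoneOn (fun s => ψ s / (1 - s * r) ^ 2) (Icc 0 1) := by
      refine monotoneOn_of_hasDerivWithinAt_nonneg (convex_Icc _ _)
        (fun s hs => (hder s hs).continuousAt.continuousWithinAt)
        (fun s hs => (hder s (interior_subset hs)).hasDerivWithinAt) (fun s hs => ?_)
      have hs' := interior_subset hs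
      have h1 := (abs_le.1 (h s hs')).1
      have h2 := mul_le_mul_of_nonneg_left h1 (sq_nonneg (1 - s * r))
      have h3 : (1 - s * r) ^ 2 * (2 * (r / (1 - s * r)) * ψ s)
          = 2 * (1 - s * r) * r * ψ s := by
        have := (hp s hs').ne'
        field_simp
      exact div_nonneg (by linarith) (by positivity)
    have := hmono (left_mem_Icc.2 zero_le_one) ha ha.1
    simp only [zero_mul, sub_zero, one_pow, div_one] at this
    rwa [le_div_iff₀ (pow_pos (hp a ha) 2), mul_comm] at this

end Comparison

/-! ### Dikin ellipsoids and comparison of Hessians. -/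

section SelfConcordant

open Filter Topology Set

variable {κ : Type*} [Fintype κ] [DecidableEq κ] {f : (κ → ℝ) → ℝ} {D : Set (κ → ℝ)}
  {x : κ → ℝ}

namespace IsSelfConcordant

theorem matNorm_line_le (hf : IsSelfConcordant D f) {h : κ → ℝ} {s : ℝ} (hs : 0 ≤ s)
    (hD : ∀ a ∈ Icc 0 s, x + a • h ∈ D) :
    matNorm (hess f (x + s • h)) h * (1 - s * matNorm (hess f x) h) ≤ matNorm (hess f x) h := by
  have := sqrt_mul_one_sub_le (φ := fun a => h ⬝ᵥ (hess f (x + a • h) *ᵥ h))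
    (φ' := fun a => third f (x + a • h) h h h) hs
    (fun a ha => hasDerivAt_hess_along h h (z := fun a => x + a • h) (hf.contDiffAt (hD a ha))
      (hasDerivAt_line x h a))
    (fun a ha => PosSemidef.dotProduct_nonneg (hf.hess_posSemidef (hD a ha)) h)
    (fun a ha => (le_abs_self _).trans (hf.abs_third_le (hD a ha) h))
  simpa [matNorm] using this

theorem segment_mem (hf : IsSelfConcordant D f) (hx : x ∈ D) {h : κ → ℝ} {s : ℝ}
    (hs : x + s • h ∈ D) {a : ℝ} (ha : a ∈ Icc 0 s) : x + a • h ∈ D := by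
  rcases eq_or_lt_of_le (ha.1.trans ha.2) with h0 | h0
  · have : a = 0 := le_antisymm (h0 ▸ ha.2) ha.1
    simpa [this] using hx
  have := hf.convexOn.1.add_smul_mem hx hs (t := a / s)
    ⟨div_nonneg ha.1 h0.le, (div_le_one h0).2 ha.2⟩
  rwa [smul_smul, div_mul_cancel₀ _ h0.ne'] at this

/-- The open Dikin ellipsoid lies in the domain. -/
theorem add_mem_of_matNorm_lt_one (hf : IsSelfConcordant D f) (hx : x ∈ D) {h : κ → ℝ}
    (hr : matNorm (hess f x) h < 1) : x + h ∈ D := by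
  set r := matNorm (hess f x) h with hrdef
  have hr0 : 0 ≤ r := matNorm_nonneg _ _
  set K := (r / (1 - r)) ^ 2 with hK
  have hK0 : 0 ≤ K := sq_nonneg _
  set C := |fderiv ℝ f x h| + K with hC
  have hC0 : 0 ≤ C := by positivity
  set S : Set ℝ := {s | x + s • h ∈ D} with hS
  have hSo : IsOpen S := hf.isOpen.preimage (by fun_prop)
  -- While the segment stays in `D`, the second derivative along it is at most `K`; integrating
  -- twice keeps `f` bounded.
  have hbound : ∀ s ∈ S ∩ Icc 0 1, f (x + s • h) ≤ f x + C := by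
    rintro s ⟨hs, hs0, hs1⟩
    have hD : ∀ a ∈ Icc 0 s, x + a • h ∈ D := fun a ha => hf.segment_mem hx hs ha
    have h2 : ∀ a ∈ Icc 0 s, h ⬝ᵥ (hess f (x + a • h) *ᵥ h) ≤ K := by
      intro a ha
      have h3 := hf.matNorm_line_le ha.1 (fun b hb => hD b ⟨hb.1, hb.2.trans ha.2⟩)
      rw [← hrdef] at h3
      have h4 : 1 - r ≤ 1 - a * r := by
        nlinarith [mul_le_mul_of_nonneg_right (ha.2.trans hs1) hr0]
      have h5 : matNorm (hess f (x + a • h)) h ≤ r / (1 - r) := by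
        rw [le_div_iff₀ (by linarith)]
        exact (mul_le_mul_of_nonneg_left h4 (matNorm_nonneg _ _)).trans h3
      rw [← matNorm_sq (hf.hess_posSemidef (hD a ha))]
      exact pow_le_pow_left₀ (matNorm_nonneg _ _) h5 2
    have hd1 : ∀ a ∈ Icc 0 s, HasDerivAt (fun a => fderiv ℝ f (x + a • h) h - K * a)
        (h ⬝ᵥ (hess f (x + a • h) *ᵥ h) - K) a := fun a ha => by
      simpa using (hasDerivAt_fderiv_along h (z := fun a => x + a • h)
        (hf.contDiffAt (hD a ha)) (hasDerivAt_line x h a)).fun_sub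
        ((hasDerivAt_id a).const_mul K)
    have hanti1 : AntitoneOn (fun a => fderiv ℝ f (x + a • h) h - K * a) (Icc 0 s) :=
      antitoneOn_of_hasDerivWithinAt_nonpos (convex_Icc _ _)
        (fun a ha => (hd1 a ha).continuousAt.continuousWithinAt)
        (fun a ha => (hd1 a (interior_subset ha)).hasDerivWithinAt)
        (fun a ha => sub_nonpos.2 (h2 a (interior_subset ha)))
    have h1 : ∀ a ∈ Icc 0 s, fderiv ℝ f (x + a • h) h ≤ C := by
      intro a ha
      have := hanti1 (left_mem_Icc.2 hs0) ha ha.1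
      simp only [zero_smul, add_zero, mul_zero, sub_zero] at this
      have h3 := le_abs_self (fderiv ℝ f x h)
      nlinarith [mul_le_mul_of_nonneg_left (ha.2.trans hs1) hK0]
    have hd0 : ∀ a ∈ Icc 0 s, HasDerivAt (fun a => f (x + a • h) - C * a)
        (fderiv ℝ f (x + a • h) h - C) a := fun a ha => by
      simpa using (hasDerivAt_along (z := fun a => x + a • h)
        (hf.contDiffAt (hD a ha)) (hasDerivAt_line x h a)).fun_sub
        ((hasDerivAt_id a).const_mul C)
    have hanti0 : AntitoneOn (fun a => f (x + a • h) - C * a) (Icc 0 s) :=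
      antitoneOn_of_hasDerivWithinAt_nonpos (convex_Icc _ _)
        (fun a ha => (hd0 a ha).continuousAt.continuousWithinAt)
        (fun a ha => (hd0 a (interior_subset ha)).hasDerivWithinAt)
        (fun a ha => sub_nonpos.2 (h1 a (interior_subset ha)))
    have := hanti0 (left_mem_Icc.2 hs0) (right_mem_Icc.2 hs0) hs0
    simp only [zero_smul, add_zero, mul_zero, sub_zero] at this
    nlinarith [mul_le_mul_of_nonneg_left hs1 hC0]
  -- The uniform bound turns closedness of the epigraph into closedness of the set of admissible
  -- parameters. This set is also open to the right, hence all of `[0, 1]`.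
  have hclosed : IsClosed (S ∩ Icc 0 1) := by
    have e : S ∩ Icc 0 1 = (fun s : ℝ => (x + s • h, f x + C)) ⁻¹'
        {p : (κ → ℝ) × ℝ | p.1 ∈ D ∧ f p.1 ≤ p.2} ∩ Icc 0 1 := by
      ext s
      constructor
      · exact fun hs => ⟨⟨hs.1, hbound s hs⟩, hs.2⟩
      · exact fun hs => ⟨hs.1.1, hs.2⟩
    rw [e]
    exact (hf.closed.preimage (by fun_prop)).inter isClosed_Icc
  have hsub := hclosed.Icc_subset_of_forall_exists_gt (by simpa [hS] using hx) (by
    rintro s ⟨hs, -⟩ y hy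
    exact nonempty_of_mem (f := 𝓝[>] s)
      (inter_mem (nhdsWithin_le_nhds (hSo.mem_nhds hs)) (Ioc_mem_nhdsGT hy)))
  simpa [hS] using hsub (right_mem_Icc.2 zero_le_one)

/-- A direction of zero curvature would put a whole line inside the Dikin ellipsoid, contradicting
boundedness of `D`. -/
theorem hess_posDef (hf : IsSelfConcordant D f) (hD : Bornology.IsBounded D) (hx : x ∈ D) :
    (hess f x).PosDef := by
  have hpsd := hf.hess_posSemidef hx
  refine Matrix.PosDef.of_dotProduct_mulVec_pos hpsd.isHermitian fun u hu => ?_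
  rw [star_trivial]
  refine lt_of_le_of_ne (PosSemidef.dotProduct_nonneg hpsd u) fun h0 => ?_
  have h1 : matNorm (hess f x) u = 0 := by rw [matNorm, ← h0, Real.sqrt_zero]
  have h2 : ∀ s : ℝ, x + s • u ∈ D := fun s =>
    hf.add_mem_of_matNorm_lt_one hx (by rw [matNorm_smul, h1, mul_zero]; exact one_pos)
  obtain ⟨R, hR⟩ := hD.exists_norm_le
  have hu' : 0 < ‖u‖ := norm_pos_iff.2 hu
  have h3 := hR _ (h2 ((R + ‖x‖ + 1) / ‖u‖))
  have h4 := hR x hx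
  have h5 : ‖((R + ‖x‖ + 1) / ‖u‖) • u‖ = R + ‖x‖ + 1 := by
    rw [norm_smul, Real.norm_eq_abs, abs_of_nonneg
      (div_nonneg (by linarith [norm_nonneg x]) hu'.le), div_mul_cancel₀ _ hu'.ne']
  have h6 := norm_sub_norm_le (((R + ‖x‖ + 1) / ‖u‖) • u) (-x)
  rw [sub_neg_eq_add, norm_neg, h5, add_comm (_ • u)] at h6
  linarith

theorem abs_third_polar_le (hf : IsSelfConcordant D f) (hD : Bornology.IsBounded D) (hx : x ∈ D)
    (h u : κ → ℝ) :
    |third f x h u u| ≤ 2 * (matNorm (hess f x) h * matNorm (hess f x) u ^ 2) :=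
  abs_trilinear_le (hf.hess_posDef hD hx) _ (third_swap_left (hf.contDiffAt hx))
    (third_swap_right (hf.contDiffAt hx)) zero_le_two (hf.abs_third_le hx) h u

/-- Comparison of the Hessians along a curve whose local speed is at most `r / (1 - s r)`. -/
theorem hess_comparison (hf : IsSelfConcordant D f) (hD : Bornology.IsBounded D)
    {z z' : ℝ → κ → ℝ} {r : ℝ} (hr0 : 0 ≤ r) (hr : r < 1) (hz : ∀ s ∈ Icc (0 : ℝ) 1, z s ∈ D)
    (hd : ∀ s ∈ Icc (0 : ℝ) 1, HasDerivAt z (z' s) s)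
    (hsp : ∀ s ∈ Icc (0 : ℝ) 1, matNorm (hess f (z s)) (z' s) ≤ r / (1 - s * r))
    {a : ℝ} (ha : a ∈ Icc (0 : ℝ) 1) (u : κ → ℝ) :
    (1 - r) * matNorm (hess f (z 1)) u ≤ (1 - a * r) * matNorm (hess f (z a)) u ∧
    (1 - a * r) * matNorm (hess f (z 0)) u ≤ matNorm (hess f (z a)) u := by
  have hp : 0 < 1 - a * r := by nlinarith [mul_le_mul_of_nonneg_right ha.2 hr0]
  have hps : ∀ s ∈ Icc (0 : ℝ) 1, (hess f (z s)).PosSemidef := fun s hs =>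
    hf.hess_posSemidef (hz s hs)
  -- The derivative of `uᵀ∇²f(z)u` is the third derivative at `(z',u,u)`, at most `2‖z'‖` times the
  -- form itself.
  have h := comparison_of_abs_deriv_le (ψ := fun s => u ⬝ᵥ (hess f (z s) *ᵥ u)) hr0 hr
    (fun s hs => hasDerivAt_hess_along u u (hf.contDiffAt (hz s hs)) (hd s hs))
    (fun s hs => by
      refine (hf.abs_third_polar_le hD (hz s hs) _ _).trans ?_
      rw [← matNorm_sq (hps s hs), mul_assoc]
      have := hsp s hs
      gcongr) ha
  simp only [← matNorm_sq (hps a ha), ← matNorm_sq (hps 0 (left_mem_Icc.2 zero_le_one)),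
    ← matNorm_sq (hps 1 (right_mem_Icc.2 zero_le_one)), ← mul_pow] at h
  exact ⟨le_of_sq_le_sq h.1 (mul_nonneg hp.le (matNorm_nonneg _ _)),
    le_of_sq_le_sq h.2 (matNorm_nonneg _ _)⟩

/-- Comparison of the Hessians at two points at local distance less than one. -/
theorem hess_dikin (hf : IsSelfConcordant D f) (hD : Bornology.IsBounded D) (hx : x ∈ D)
    {h : κ → ℝ} (hr : matNorm (hess f x) h < 1) (u : κ → ℝ) :
    matNorm (hess f (x + h)) u ≤ (1 - matNorm (hess f x) h)⁻¹ * matNorm (hess f x) u ∧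
    matNorm (hess f x) u ≤ (1 - matNorm (hess f x) h)⁻¹ * matNorm (hess f (x + h)) u := by
  have hr0 := matNorm_nonneg (hess f x) h
  have hmem : x + (1 : ℝ) • h ∈ D := by
    rw [one_smul]; exact hf.add_mem_of_matNorm_lt_one hx hr
  have hseg : ∀ s ∈ Icc (0 : ℝ) 1, x + s • h ∈ D := fun s hs => hf.segment_mem hx hmem hs
  have key := fun a (ha : a ∈ Icc (0 : ℝ) 1) =>
    hf.hess_comparison hD (z := fun s => x + s • h) (z' := fun _ => h) hr0 hr hseg
    (fun s _ => hasDerivAt_line x h s) (fun s hs => by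
      rw [le_div_iff₀ (by nlinarith [mul_le_mul_of_nonneg_right hs.2 hr0])]
      exact hf.matNorm_line_le hs.1 fun b hb => hseg b ⟨hb.1, hb.2.trans hs.2⟩) ha u
  have h1 := (key 0 (left_mem_Icc.2 zero_le_one)).1
  have h2 := (key 1 (right_mem_Icc.2 zero_le_one)).2
  simp only [zero_smul, add_zero, one_smul, zero_mul, sub_zero, one_mul] at h1 h2
  have hp : 0 < 1 - matNorm (hess f x) h := by linarith
  constructor
  · rwa [← div_eq_inv_mul, le_div_iff₀ hp, mul_comm]
  · rwa [← div_eq_inv_mul, le_div_iff₀ hp, mul_comm]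

end IsSelfConcordant

end SelfConcordant

/-! ### The inverse gradient map and its Newton approximation. -/

section Conjugate

open Filter Topology Set

variable {κ : Type*} [Fintype κ] [DecidableEq κ] {f : (κ → ℝ) → ℝ} {D : Set (κ → ℝ)}
  {x : κ → ℝ}

theorem hasDerivAt_hess_mulVec_along (u : κ → ℝ) {z V : ℝ → κ → ℝ} {z' V' : κ → ℝ} {s : ℝ}
    (hf : ContDiffAt ℝ 3 f (z s)) (hz : HasDerivAt z z' s) (hV : HasDerivAt V V' s) :
    HasDerivAt (fun s => u ⬝ᵥ (hess f (z s) *ᵥ V s))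
      (third f (z s) z' u (V s) + u ⬝ᵥ (hess f (z s) *ᵥ V')) s := by
  simp only [dotProduct_hess_mulVec]
  have h1 : HasFDerivAt (fun y => fderiv ℝ (fderiv ℝ f) y u) ((third f (z s)).flip u) (z s) := by
    refine ((hasFDerivAt_fderiv_fderiv hf).clm_apply (hasFDerivAt_const u _)).congr_fderiv ?_
    ext w
    simp
  exact (h1.comp_hasDerivAt s hz).clm_apply hV

theorem contDiffAt_grad (hf : ContDiffAt ℝ 3 f x) : ContDiffAt ℝ 2 (grad f) x :=
  contDiffAt_pi.2 fun _ => (ContDiffAt.fderiv_one hf).clm_apply contDiffAt_const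

theorem hasFDerivAt_grad (hf : ContDiffAt ℝ 3 f x) :
    HasFDerivAt (grad f) (LinearMap.toContinuousLinearMap (hess f x).mulVecLin) x := by
  have h0 : HasFDerivAt (fderiv ℝ f) (fderiv ℝ (fderiv ℝ f) x) x :=
    ((ContDiffAt.fderiv_one hf).differentiableAt (by norm_num)).hasFDerivAt
  rw [hasFDerivAt_pi']
  intro i
  refine (h0.clm_apply (hasFDerivAt_const (Pi.single i 1) x)).congr_fderiv ?_
  ext w
  have h1 := dotProduct_hess_mulVec f x (Pi.single i 1) w
  have h2 := dotProduct_mulVec_comm (hess_isHermitian hf) (Pi.single i 1) w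
  rw [dotProduct_hess_mulVec f x w] at h2
  simp only [single_dotProduct, one_mul] at h2
  simp [← h2]

namespace IsSelfConcordant

/-- A closed convex function with bounded domain attains its minimum after any linear
perturbation. -/
theorem exists_min (hf : IsSelfConcordant D f) (hD : Bornology.IsBounded D) (hne : D.Nonempty)
    (c : κ → ℝ) : ∃ x ∈ D, ∀ y ∈ D, f x - c ⬝ᵥ x ≤ f y - c ⬝ᵥ y := by
  obtain ⟨x₀, hx₀⟩ := hne
  -- A sublevel set of `f - cᵀx`. Although `D` is open, it is closed, being a preimage of the
  -- epigraph.
  set K : Set (κ → ℝ) := {x | x ∈ D ∧ f x ≤ f x₀ - c ⬝ᵥ x₀ + c ⬝ᵥ x} with hK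
  have hcont : Continuous fun x : κ → ℝ => c ⬝ᵥ x := by fun_prop
  have hKc : IsClosed K :=
    hf.closed.preimage (f := fun x : κ → ℝ => (x, f x₀ - c ⬝ᵥ x₀ + c ⬝ᵥ x)) (by fun_prop)
  have hKcomp : IsCompact K :=
    Metric.isCompact_of_isClosed_isBounded hKc (hD.subset fun x hx => hx.1)
  have hfc : ContinuousOn (fun x => f x - c ⬝ᵥ x) K :=
    (hf.contDiffOn.continuousOn.mono fun x hx => hx.1).sub hcont.continuousOn
  obtain ⟨x, hx, hmin⟩ := hKcomp.exists_isMinOn ⟨x₀, hx₀, by simp⟩ hfc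
  refine ⟨x, hx.1, fun y hy => ?_⟩
  by_cases hyK : y ∈ K
  · exact hmin hyK
  · have h1 : f x₀ - c ⬝ᵥ x₀ + c ⬝ᵥ y < f y := by
      by_contra h; exact hyK ⟨hy, not_lt.1 h⟩
    linarith [hx.2]

theorem grad_eq_of_min (hf : IsSelfConcordant D f) (hx : x ∈ D) {c : κ → ℝ}
    (h : ∀ y ∈ D, f x - c ⬝ᵥ x ≤ f y - c ⬝ᵥ y) : grad f x = c := by
  have hloc : IsLocalMin (fun y => f y - c ⬝ᵥ y) x :=
    eventually_of_mem (hf.isOpen.mem_nhds hx) h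
  ext i
  have h1 := hasDerivAt_along (z := fun s : ℝ => x + s • (Pi.single i 1 : κ → ℝ)) (s := 0)
    (by simpa using hf.contDiffAt hx) (hasDerivAt_line x (Pi.single i 1) 0)
  have h2 : HasDerivAt (fun s : ℝ => c ⬝ᵥ (x + s • (Pi.single i 1 : κ → ℝ))) (c i) 0 := by
    simpa [dotProduct_add] using ((hasDerivAt_id (0 : ℝ)).mul_const (c i)).const_add (c ⬝ᵥ x)
  have h3 : IsLocalMin (fun s : ℝ => f (x + s • (Pi.single i 1 : κ → ℝ))
      - c ⬝ᵥ (x + s • (Pi.single i 1 : κ → ℝ))) 0 := by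
    have hc : ContinuousAt (fun s : ℝ => x + s • (Pi.single i 1 : κ → ℝ)) 0 := by fun_prop
    have h5 : ∀ᶠ y in 𝓝 (x + (0 : ℝ) • (Pi.single i 1 : κ → ℝ)),
        f x - c ⬝ᵥ x ≤ f y - c ⬝ᵥ y := by rw [zero_smul, add_zero]; exact hloc
    filter_upwards [hc.eventually h5] with s hs
    simpa using hs
  have h4 := h3.hasDerivAt_eq_zero (h1.fun_sub h2)
  simp only [zero_smul, add_zero] at h4
  simp only [grad]
  linarith

theorem exists_grad_eq (hf : IsSelfConcordant D f) (hD : Bornology.IsBounded D)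
    (hne : D.Nonempty) (c : κ → ℝ) : ∃ x ∈ D, grad f x = c := by
  obtain ⟨x, hx, h⟩ := hf.exists_min hD hne c
  exact ⟨x, hx, hf.grad_eq_of_min hx h⟩

/-- Along the segment joining two points, the directional derivative is strictly increasing because
the Hessian is positive definite. -/
theorem grad_injOn (hf : IsSelfConcordant D f) (hD : Bornology.IsBounded D) :
    InjOn (grad f) D := by
  intro x hx y hy hxy
  by_contra hne
  have hu : y - x ≠ 0 := sub_ne_zero.2 (Ne.symm hne)
  have hseg : ∀ s ∈ Icc (0 : ℝ) 1, x + s • (y - x) ∈ D := fun s hs =>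
    hf.segment_mem hx (s := 1) (by simpa using hy) hs
  have hd : ∀ s ∈ Icc (0 : ℝ) 1, HasDerivAt (fun s => fderiv ℝ f (x + s • (y - x)) (y - x))
      ((y - x) ⬝ᵥ (hess f (x + s • (y - x)) *ᵥ (y - x))) s := fun s hs =>
    hasDerivAt_fderiv_along (y - x) (z := fun s : ℝ => x + s • (y - x)) (hf.contDiffAt (hseg s hs))
      (hasDerivAt_line x (y - x) s)
  have hmono : StrictMonoOn (fun s : ℝ => fderiv ℝ f (x + s • (y - x)) (y - x)) (Icc 0 1) :=
    strictMonoOn_of_hasDerivWithinAt_pos (convex_Icc _ _)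
      (fun s hs => (hd s hs).continuousAt.continuousWithinAt)
      (fun s hs => (hd s (interior_subset hs)).hasDerivWithinAt)
      (fun s hs => PosDef.dotProduct_pos (hf.hess_posDef hD (hseg s (interior_subset hs))) hu)
  have := hmono (left_mem_Icc.2 zero_le_one) (right_mem_Icc.2 zero_le_one) zero_lt_one
  simp only [zero_smul, add_zero, one_smul, add_sub_cancel, ← grad_dotProduct, hxy] at this
  exact lt_irrefl _ this

end IsSelfConcordant

/-- The inverse of the gradient map on `D`. -/
def gradInv (f : (κ → ℝ) → ℝ) (D : Set (κ → ℝ)) (c : κ → ℝ) : κ → ℝ :=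
  Classical.epsilon fun x => x ∈ D ∧ grad f x = c

namespace IsSelfConcordant

theorem gradInv_spec (hf : IsSelfConcordant D f) (hD : Bornology.IsBounded D)
    (hne : D.Nonempty) (c : κ → ℝ) : gradInv f D c ∈ D ∧ grad f (gradInv f D c) = c :=
  Classical.epsilon_spec (p := fun x => x ∈ D ∧ grad f x = c) (hf.exists_grad_eq hD hne c)

theorem gradInv_grad (hf : IsSelfConcordant D f) (hD : Bornology.IsBounded D) (hx : x ∈ D) :
    gradInv f D (grad f x) = x :=
  have h := hf.gradInv_spec hD ⟨x, hx⟩ (grad f x)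
  hf.grad_injOn hD h.1 hx h.2

/-- The inverse function theorem gives a `C²` local inverse of the gradient; injectivity identifies
it with the global one. Two derivatives are what the Taylor argument of `newton_error` requires. -/
theorem contDiffAt_gradInv (hf : IsSelfConcordant D f) (hD : Bornology.IsBounded D)
    (hne : D.Nonempty) (c : κ → ℝ) : ContDiffAt ℝ 2 (gradInv f D) c := by
  obtain ⟨hx, hxc⟩ := hf.gradInv_spec hD hne c
  set x := gradInv f D c
  have hpd := hf.hess_posDef hD hx
  let e : (κ → ℝ) ≃L[ℝ] (κ → ℝ) := LinearEquiv.toContinuousLinearEquiv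
    { (hess f x).mulVecLin with
      invFun := fun u => (hess f x)⁻¹ *ᵥ u
      left_inv := fun u => PosDef.inv_mulVec_mulVec hpd u
      right_inv := fun u => PosDef.mulVec_inv_mulVec hpd u }
  have hg := contDiffAt_grad (hf.contDiffAt hx)
  have hd : HasFDerivAt (grad f) (e : (κ → ℝ) →L[ℝ] (κ → ℝ)) x :=
    (hasFDerivAt_grad (hf.contDiffAt hx)).congr_fderiv (by ext; rfl)
  have hloc := hg.to_localInverse hd two_ne_zero
  rw [hxc] at hloc
  refine hloc.congr_of_eventuallyEq ?_
  have hstrict := hg.hasStrictFDerivAt' hd two_ne_zero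
  have h1 : ∀ᶠ y in 𝓝 c, grad f (hg.localInverse hd two_ne_zero y) = y := by
    have := hstrict.eventually_right_inverse
    rwa [hxc] at this
  have h2 : ∀ᶠ y in 𝓝 c, hg.localInverse hd two_ne_zero y ∈ D := by
    have h3 : hg.localInverse hd two_ne_zero c = x := by
      have := hstrict.localInverse_apply_image
      rwa [hxc] at this
    exact hloc.continuousAt.eventually_mem (hf.isOpen.mem_nhds (by rw [h3]; exact hx))
  filter_upwards [h1, h2] with y hy1 hy2
  rw [← hf.gradInv_grad hD hy2, hy1]

theorem hess_mulVec_fderiv_gradInv (hf : IsSelfConcordant D f) (hD : Bornology.IsBounded D)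
    (hne : D.Nonempty) (c v : κ → ℝ) :
    hess f (gradInv f D c) *ᵥ fderiv ℝ (gradInv f D) c v = v := by
  have h1 := ((hf.contDiffAt_gradInv hD hne c).differentiableAt two_ne_zero).hasFDerivAt
  have h2 := (hasFDerivAt_grad (hf.contDiffAt (hf.gradInv_spec hD hne c).1)).comp c h1
  have h3 : grad f ∘ gradInv f D = id := funext fun c => (hf.gradInv_spec hD hne c).2
  rw [h3] at h2
  exact congrArg (fun L => L v) (h2.unique (hasFDerivAt_id c))

/-- The error of the Newton approximation for the inverse of the gradient map, and the comparison
of Hessians, in terms of the dual norm of the difference of the gradients. -/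
theorem newton_error (hf : IsSelfConcordant D f) (hD : Bornology.IsBounded D) {y : κ → ℝ}
    (hx : x ∈ D) (hy : y ∈ D) {v : κ → ℝ} (hv : grad f y = grad f x + v)
    (hσ : matNorm (hess f x)⁻¹ v < 1) :
    (∀ u, (1 - matNorm (hess f x)⁻¹ v) * matNorm (hess f y) u ≤ matNorm (hess f x) u) ∧
    matNorm (hess f y) (y - x - (hess f x)⁻¹ *ᵥ v) ≤
      (matNorm (hess f x)⁻¹ v / (1 - matNorm (hess f x)⁻¹ v)) ^ 2 := by
  have hne : D.Nonempty := ⟨x, hx⟩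
  set c := grad f x with hc
  set σ := matNorm (hess f x)⁻¹ v with hσdef
  have hσ0 : 0 ≤ σ := matNorm_nonneg _ _
  set g := gradInv f D with hg
  -- The path whose gradient moves linearly from `∇f(x)` to `∇f(y)`; `V` and `W` are its velocity
  -- and acceleration.
  set X : ℝ → κ → ℝ := fun s => g (c + s • v) with hX
  set V : ℝ → κ → ℝ := fun s => fderiv ℝ g (c + s • v) v with hV
  set W : ℝ → κ → ℝ := fun s => fderiv ℝ (fderiv ℝ g) (c + s • v) v v with hW
  have hgc : ∀ c, ContDiffAt ℝ 2 g c := hf.contDiffAt_gradInv hD hne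
  have hXD : ∀ s, X s ∈ D := fun s => (hf.gradInv_spec hD hne _).1
  have hXd : ∀ s, HasDerivAt X (V s) s := fun s =>
    ((hgc _).differentiableAt two_ne_zero).hasFDerivAt.comp_hasDerivAt s (hasDerivAt_line c v s)
  have hVd : ∀ s, HasDerivAt V (W s) s := fun s => by
    have h1 : ContDiffAt ℝ 1 (fderiv ℝ g) (c + s • v) := (hgc _).fderiv_right (by norm_num)
    have h2 := (h1.differentiableAt one_ne_zero).hasFDerivAt.clm_apply (hasFDerivAt_const v _)
    have h3 := h2.comp_hasDerivAt s (hasDerivAt_line c v s)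
    refine h3.congr_deriv ?_
    simp [hW]
  have hpd : ∀ s, (hess f (X s)).PosDef := fun s => hf.hess_posDef hD (hXD s)
  have hHV : ∀ s, hess f (X s) *ᵥ V s = v := fun s => hf.hess_mulVec_fderiv_gradInv hD hne _ _
  -- Differentiating the constant `uᵀ∇²f(X)V = uᵀv` expresses the acceleration through the third
  -- derivative.
  have hHW : ∀ s u, u ⬝ᵥ (hess f (X s) *ᵥ W s) = -third f (X s) u (V s) (V s) := by
    intro s u
    have h1 := hasDerivAt_hess_mulVec_along u (hf.contDiffAt (hXD s)) (hXd s) (hVd s)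
    simp only [hHV] at h1
    have h2 := h1.unique (hasDerivAt_const s (u ⬝ᵥ v))
    rw [third_swap_left (hf.contDiffAt (hXD s)) u]
    linarith
  have hvW : ∀ s, v ⬝ᵥ W s = -third f (X s) (V s) (V s) (V s) := fun s => by
    rw [← hHW, dotProduct_mulVec_comm (hpd s).isHermitian, hHV, dotProduct_comm]
  have hvV : ∀ s, v ⬝ᵥ V s = V s ⬝ᵥ (hess f (X s) *ᵥ V s) := fun s => by
    rw [hHV, dotProduct_comm]
  have hdot : ∀ (u : κ → ℝ) {Y : ℝ → κ → ℝ} {Y' : κ → ℝ} {s : ℝ}, HasDerivAt Y Y' s →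
      HasDerivAt (fun s => u ⬝ᵥ Y s) (u ⬝ᵥ Y') s := by
    intro u Y Y' s hY
    simp only [dotProduct]
    exact HasDerivAt.fun_sum fun i _ => (hasDerivAt_pi.1 hY i).const_mul (u i)
  have hX0 : X 0 = x := by
    simp only [hX, zero_smul, add_zero]; exact hf.gradInv_grad hD hx
  have hX1 : X 1 = y := by
    simp only [hX, one_smul, ← hv]; exact hf.gradInv_grad hD hy
  have hV0 : V 0 = (hess f x)⁻¹ *ᵥ v := by
    have h1 := PosDef.inv_mulVec_mulVec (hpd 0) (V 0)
    rwa [hHV, hX0, eq_comm] at h1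
  have hnV0 : matNorm (hess f (X 0)) (V 0) = σ := by
    rw [hV0, hX0, matNorm_mulVec_inv (hf.hess_posDef hD hx)]
  have hp : ∀ s ∈ Icc (0 : ℝ) 1, 0 < 1 - s * σ := fun s hs => by
    nlinarith [mul_le_mul_of_nonneg_right hs.2 hσ0]
  have hspeed : ∀ s ∈ Icc (0 : ℝ) 1, matNorm (hess f (X s)) (V s) ≤ σ / (1 - s * σ) := by
    intro s hs
    rw [le_div_iff₀ (hp s hs)]
    -- Here `vᵀV` is the squared local speed and its derivative is `-T(V,V,V)`, so the same scalar
    -- inequality applies as on straight lines.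
    have := sqrt_mul_one_sub_le (φ := fun a => v ⬝ᵥ V a) (φ' := fun a => v ⬝ᵥ W a) hs.1
      (fun a _ => hdot v (hVd a))
      (fun a _ => by
        rw [hvV]; exact PosSemidef.dotProduct_nonneg (hpd a).posSemidef _)
      (fun a _ => by
        rw [hvW, hvV]
        exact (neg_le_abs _).trans (hf.abs_third_le (hXD a) _))
    simp only [hvV] at this
    change matNorm _ _ * (1 - s * matNorm _ _) ≤ matNorm _ _ at this
    rwa [hnV0] at this
  have hcomp := fun a (ha : a ∈ Icc (0 : ℝ) 1) => hf.hess_comparison hD hσ0 hσ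
    (fun s _ => hXD s) (fun s _ => hXd s) hspeed ha
  have h1σ : 0 < 1 - σ := by linarith
  refine ⟨fun u => ?_, ?_⟩
  · have := (hcomp 0 (left_mem_Icc.2 zero_le_one) u).1
    simpa [hX0, hX1] using this
  · have hpdy := hf.hess_posDef hD hy
    refine matNorm_le_of_forall_dual hpdy (sq_nonneg _) fun u => ?_
    set Z := matNorm (hess f y)⁻¹ u with hZ
    have hZ0 : 0 ≤ Z := matNorm_nonneg _ _
    set C := (σ / (1 - σ)) ^ 2 * Z with hC
    -- The Hessian comparison costs `(1-sσ)/(1-σ)` and the squared speed contributes `σ²/(1-sσ)²`;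
    -- their product is at most `(σ/(1-σ))²`. The factor 2 disappears in the double integration
    -- below.
    have huW : ∀ s ∈ Icc (0 : ℝ) 1, u ⬝ᵥ W s ≤ 2 * C := by
      intro s hs
      have h1 := hHW s ((hess f (X s))⁻¹ *ᵥ u)
      rw [dotProduct_mulVec_comm (hpd s).isHermitian, PosDef.mulVec_inv_mulVec (hpd s),
        dotProduct_comm] at h1
      have h2 := hf.abs_third_polar_le hD (hXD s) ((hess f (X s))⁻¹ *ᵥ u) (V s)
      rw [matNorm_mulVec_inv (hpd s)] at h2
      have h3 : matNorm (hess f (X s))⁻¹ u ≤ (1 - s * σ) / (1 - σ) * Z := by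
        refine matNorm_inv_le (hpd s) hpdy (fun w => ?_) u
        have := (hcomp s hs w).1
        rw [hX1] at this
        rw [div_mul_eq_mul_div, le_div_iff₀ h1σ]
        linarith
      have h4 := hspeed s hs
      have h5 := hp s hs
      have h6 : 1 - σ ≤ 1 - s * σ := by nlinarith [mul_le_mul_of_nonneg_right hs.2 hσ0]
      calc u ⬝ᵥ W s ≤ |third f (X s) ((hess f (X s))⁻¹ *ᵥ u) (V s) (V s)| := by
            rw [h1]; exact neg_le_abs _
        _ ≤ 2 * (matNorm (hess f (X s))⁻¹ u * matNorm (hess f (X s)) (V s) ^ 2) := h2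
        _ ≤ 2 * (((1 - s * σ) / (1 - σ) * Z) * (σ / (1 - s * σ)) ^ 2) := by
            have := matNorm_nonneg (hess f (X s)) (V s)
            gcongr
        _ = 2 * ((σ ^ 2 / ((1 - σ) * (1 - s * σ))) * Z) := by
            field_simp
        _ ≤ 2 * ((σ ^ 2 / ((1 - σ) * (1 - σ))) * Z) := by
            gcongr
        _ = 2 * C := by
            rw [hC, div_pow]; ring
    have hd1 : ∀ s, HasDerivAt (fun s => u ⬝ᵥ V s - 2 * C * s) (u ⬝ᵥ W s - 2 * C) s := fun s => by
      simpa using (hdot u (hVd s)).fun_sub ((hasDerivAt_id s).const_mul (2 * C))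
    have hanti1 : AntitoneOn (fun s => u ⬝ᵥ V s - 2 * C * s) (Icc 0 1) :=
      antitoneOn_of_hasDerivWithinAt_nonpos (convex_Icc _ _)
        (fun s _ => (hd1 s).continuousAt.continuousWithinAt)
        (fun s _ => (hd1 s).hasDerivWithinAt)
        (fun s hs => sub_nonpos.2 (huW s (interior_subset hs)))
    have hd0 : ∀ s, HasDerivAt (fun s => u ⬝ᵥ X s - u ⬝ᵥ V 0 * s - C * s ^ 2)
        (u ⬝ᵥ V s - u ⬝ᵥ V 0 - C * (2 * s)) s := fun s => by
      simpa using ((hdot u (hXd s)).fun_sub ((hasDerivAt_id s).const_mul (u ⬝ᵥ V 0))).fun_sub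
        (((hasDerivAt_id s).fun_pow 2).const_mul C)
    have hanti0 : AntitoneOn (fun s => u ⬝ᵥ X s - u ⬝ᵥ V 0 * s - C * s ^ 2) (Icc 0 1) :=
      antitoneOn_of_hasDerivWithinAt_nonpos (convex_Icc _ _)
        (fun s _ => (hd0 s).continuousAt.continuousWithinAt)
        (fun s _ => (hd0 s).hasDerivWithinAt)
        (fun s hs => by
          have hs' := interior_subset hs
          have := hanti1 (left_mem_Icc.2 zero_le_one) hs' hs'.1
          simp only [mul_zero, sub_zero] at this
          linarith)
    have := hanti0 (left_mem_Icc.2 zero_le_one) (right_mem_Icc.2 zero_le_one) zero_le_one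
    simp only [hX0, hX1, hV0] at this
    rw [dotProduct_sub, dotProduct_sub]
    linarith

end IsSelfConcordant

end Conjugate

/-! ### Derivatives of the Legendre conjugate. -/

section ConjugateDerivative

variable {κ : Type*} [Fintype κ] [DecidableEq κ] {f : (κ → ℝ) → ℝ} {D : Set (κ → ℝ)}

/-- The dot product as a continuous bilinear map. -/
def dotCLM (κ : Type*) [Fintype κ] : (κ → ℝ) →L[ℝ] (κ → ℝ) →L[ℝ] ℝ :=
  ∑ i, (ContinuousLinearMap.proj i : (κ → ℝ) →L[ℝ] ℝ).smulRight
    (ContinuousLinearMap.proj i : (κ → ℝ) →L[ℝ] ℝ)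

@[simp] theorem dotCLM_apply (u v : κ → ℝ) : dotCLM κ u v = u ⬝ᵥ v := by
  simp [dotCLM, dotProduct]

/-- The Legendre conjugate of `f`, computed from the inverse of its gradient. -/
def conjugate (f : (κ → ℝ) → ℝ) (D : Set (κ → ℝ)) (c : κ → ℝ) : ℝ :=
  c ⬝ᵥ gradInv f D c - f (gradInv f D c)

/-- Envelope argument: the terms containing the derivative of `gradInv` cancel because `∇f = c` at
that point. -/
theorem IsSelfConcordant.hasFDerivAt_conjugate (hf : IsSelfConcordant D f)
    (hD : Bornology.IsBounded D) (hne : D.Nonempty) (c : κ → ℝ) :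
    HasFDerivAt (conjugate f D) (dotCLM κ (gradInv f D c)) c := by
  have h1 := ((hf.contDiffAt_gradInv hD hne c).differentiableAt two_ne_zero).hasFDerivAt
  obtain ⟨hx, hxc⟩ := hf.gradInv_spec hD hne c
  have h2 := ((hf.contDiffAt hx).differentiableAt (by norm_num)).hasFDerivAt.comp c h1
  have h3 := (((dotCLM κ).hasFDerivAt (x := c)).clm_apply h1).fun_sub h2
  have e : conjugate f D = fun c => dotCLM κ c (gradInv f D c) - (f ∘ gradInv f D) c := by
    ext c; simp [conjugate]
  rw [e]
  refine h3.congr_fderiv ?_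
  ext v
  simp [← grad_dotProduct f, hxc, dotProduct_comm]

/-- Gradient and Hessian of `z ↦ f^*(c + A^T z) - b^T z`. -/
theorem IsSelfConcordant.grad_hess_conjugate_comp {ι : Type*} [Fintype ι] [DecidableEq ι]
    (hf : IsSelfConcordant D f) (hD : Bornology.IsBounded D) (hne : D.Nonempty) (c : κ → ℝ)
    (A : Matrix ι κ ℝ) (b : ι → ℝ) (k : ℝ) (y : ι → ℝ) :
    grad (fun z => conjugate f D (c + Aᵀ *ᵥ z) + k - b ⬝ᵥ z) y
      = A *ᵥ gradInv f D (c + Aᵀ *ᵥ y) - b ∧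
    hess (fun z => conjugate f D (c + Aᵀ *ᵥ z) + k - b ⬝ᵥ z) y
      = A * (hess f (gradInv f D (c + Aᵀ *ᵥ y)))⁻¹ * Aᵀ := by
  set L : (ι → ℝ) →L[ℝ] (κ → ℝ) := LinearMap.toContinuousLinearMap Aᵀ.mulVecLin with hL
  set Lt : (κ → ℝ) →L[ℝ] (ι → ℝ) := LinearMap.toContinuousLinearMap A.mulVecLin with hLt
  have hLd : ∀ z, HasFDerivAt (fun z => c + Aᵀ *ᵥ z) L z := fun z => L.hasFDerivAt.const_add c
  have hd : ∀ z, HasFDerivAt (fun z => conjugate f D (c + Aᵀ *ᵥ z) + k - b ⬝ᵥ z)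
      (dotCLM ι (A *ᵥ gradInv f D (c + Aᵀ *ᵥ z) - b)) z := by
    intro z
    have h1 := (((hf.hasFDerivAt_conjugate hD hne (c + Aᵀ *ᵥ z)).comp z (hLd z)).add_const
      k).fun_sub (dotCLM ι b).hasFDerivAt
    simp only [dotCLM_apply] at h1
    refine h1.congr_fderiv ?_
    ext v
    simp only [hL, _root_.sub_apply, ContinuousLinearMap.comp_apply, dotCLM_apply, sub_dotProduct,
      LinearMap.coe_toContinuousLinearMap', Matrix.mulVecLin_apply]
    rw [Matrix.dotProduct_mulVec, Matrix.vecMul_transpose]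
  have hfd : fderiv ℝ (fun z => conjugate f D (c + Aᵀ *ᵥ z) + k - b ⬝ᵥ z)
      = fun z => dotCLM ι (A *ᵥ gradInv f D (c + Aᵀ *ᵥ z) - b) := funext fun z => (hd z).fderiv
  constructor
  · ext i
    simp [grad, hfd]
  · have hpd := hf.hess_posDef hD (hf.gradInv_spec hD hne (c + Aᵀ *ᵥ y)).1
    have h1 := ((hf.contDiffAt_gradInv hD hne (c + Aᵀ *ᵥ y)).differentiableAt
      two_ne_zero).hasFDerivAt
    have hX : ∀ v, fderiv ℝ (gradInv f D) (c + Aᵀ *ᵥ y) v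
        = (hess f (gradInv f D (c + Aᵀ *ᵥ y)))⁻¹ *ᵥ v := fun v => by
      rw [← PosDef.inv_mulVec_mulVec hpd (fderiv ℝ (gradInv f D) (c + Aᵀ *ᵥ y) v),
        hf.hess_mulVec_fderiv_gradInv hD hne]
    have h2 := (dotCLM ι).hasFDerivAt.comp y
      ((Lt.hasFDerivAt.comp y (h1.comp y (hLd y))).sub_const b)
    have h3 : HasFDerivAt (fun z => dotCLM ι (A *ᵥ gradInv f D (c + Aᵀ *ᵥ z) - b)) _ y := h2
    have hS : (A * (hess f (gradInv f D (c + Aᵀ *ᵥ y)))⁻¹ * Aᵀ).IsHermitian := by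
      simpa using Matrix.isHermitian_mul_mul_conjTranspose A hpd.inv.isHermitian
    ext i j
    -- Differentiating the gradient produces the entry `(j, i)`, so the target is transposed first.
    rw [← hS.apply i j, star_trivial]
    change iteratedFDeriv ℝ 2 _ y ![Pi.single i 1, Pi.single j 1] = _
    rw [iteratedFDeriv_two_apply, hfd, h3.fderiv]
    simp only [Matrix.cons_val_zero, Matrix.cons_val_one, ContinuousLinearMap.comp_apply, hL, hLt,
      LinearMap.coe_toContinuousLinearMap', Matrix.mulVecLin_apply, hX, dotCLM_apply,
      Matrix.mulVec_mulVec, dotProduct_single, mul_one]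
    rw [← Matrix.mul_assoc, Matrix.mulVec_single_one]
    rfl

end ConjugateDerivative

/-! ### Self-concordance of the separable sum. -/

namespace SeparableProblem

variable {M m : ℕ} {n : Fin M → ℕ} (P : SeparableProblem M m n)

/-- The map `x ↦ xᵢ` as a continuous linear map. -/
def blockCLM (n : Fin M → ℕ) (i : Fin M) : PrimalVec n →L[ℝ] (Fin (n i) → ℝ) :=
  ContinuousLinearMap.pi fun j => ContinuousLinearMap.proj ⟨i, j⟩

theorem blockCLM_apply (i : Fin M) (x : PrimalVec n) : blockCLM n i x = block x i := rfl

theorem fullF_eq_sum : P.fullF = ∑ i, P.F i ∘ blockCLM n i := by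
  ext x; simp [fullF, blockCLM_apply]

variable {P}

theorem isOpen_domF : IsOpen P.domF := by
  have : P.domF = ⋂ i, blockCLM n i ⁻¹' interior (P.X i) := by
    ext x; simp [domF, blockCLM_apply]
  rw [this]
  exact isOpen_iInter_of_finite fun i => isOpen_interior.preimage (blockCLM n i).continuous

theorem isBounded_domF (hb : ∀ i, Bornology.IsBounded (P.X i)) : Bornology.IsBounded P.domF := by
  choose R hR using fun i => (hb i).exists_norm_le
  refine isBounded_iff_forall_norm_le.2 ⟨∑ i, |R i|, fun x hx => ?_⟩
  refine (pi_norm_le_iff_of_nonneg (Finset.sum_nonneg fun i _ => abs_nonneg _)).2 fun p => ?_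
  calc ‖x p‖ = ‖block x p.1 p.2‖ := rfl
    _ ≤ ‖block x p.1‖ := norm_le_pi_norm _ _
    _ ≤ R p.1 := hR _ _ (interior_subset (hx p.1))
    _ ≤ |R p.1| := le_abs_self _
    _ ≤ ∑ i, |R i| := Finset.single_le_sum (f := fun i => |R i|) (fun i _ => abs_nonneg _)
        (Finset.mem_univ _)

theorem domF_nonempty (hne : ∀ i, (interior (P.X i)).Nonempty) : P.domF.Nonempty := by
  choose x hx using hne
  exact ⟨fun p => x p.1 p.2, hx⟩

theorem iteratedFDeriv_fullF (hF : ∀ i, IsSelfConcordant (interior (P.X i)) (P.F i))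
    {x : PrimalVec n} (hx : x ∈ P.domF) {k : ℕ} (hk : k ≤ 3)
    (v : Fin k → PrimalVec n) :
    iteratedFDeriv ℝ k P.fullF x v =
      ∑ i, iteratedFDeriv ℝ k (P.F i) (block x i) (fun j => block (v j) i) := by
  have hk' : ((k : ℕ) : WithTop ℕ∞) ≤ 3 := by exact_mod_cast hk
  rw [fullF_eq_sum, iteratedFDeriv_sum_apply, _root_.sum_apply]
  · refine Finset.sum_congr rfl fun i _ => ?_
    have ho : IsOpen (blockCLM n i ⁻¹' interior (P.X i)) :=
      isOpen_interior.preimage (blockCLM n i).continuous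
    have h := (blockCLM n i).iteratedFDerivWithin_comp_right (hF i).contDiffOn
      isOpen_interior.uniqueDiffOn ho.uniqueDiffOn (x := x) (hx i) hk'
    rw [iteratedFDerivWithin_of_isOpen k ho (hx i),
      iteratedFDerivWithin_of_isOpen k isOpen_interior
        (show blockCLM n i x ∈ interior (P.X i) from hx i)] at h
    rw [h]
    rfl
  · exact fun i _ => (((hF i).contDiffAt (hx i)).of_le hk').comp x
      (blockCLM n i).contDiff.contDiffAt

theorem dotProduct_hess_fullF (hF : ∀ i, IsSelfConcordant (interior (P.X i)) (P.F i))
    {x : PrimalVec n} (hx : x ∈ P.domF) (u : PrimalVec n) :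
    u ⬝ᵥ (hess P.fullF x *ᵥ u) =
      ∑ i, block u i ⬝ᵥ (hess (P.F i) (block x i) *ᵥ block u i) := by
  have h := iteratedFDeriv_fullF hF hx (k := 2) (by norm_num) ![u, u]
  simpa [iteratedFDeriv_two_apply, dotProduct_hess_mulVec] using h

theorem isSelfConcordant_fullF (hF : ∀ i, IsSelfConcordant (interior (P.X i)) (P.F i))
    (hb : ∀ i, Bornology.IsBounded (P.X i))
    (hne : ∀ i, (interior (P.X i)).Nonempty) : IsSelfConcordant P.domF P.fullF where
  isOpen := isOpen_domF
  contDiffOn := by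
    rw [fullF_eq_sum]
    intro x hx
    have : ContDiffAt ℝ 3 (∑ i, P.F i ∘ blockCLM n i) x := by
      have h := ContDiffAt.sum (𝕜 := ℝ) (n := 3) (s := Finset.univ) (x := x)
        (f := fun i => P.F i ∘ blockCLM n i) fun i _ =>
        ((hF i).contDiffAt (hx i)).comp x (blockCLM n i).contDiff.contDiffAt
      convert! h using 1
      ext x; simp
    exact this.contDiffWithinAt
  convexOn := by
    refine ⟨fun x hx y hy a b ha hb' hab i => (hF i).convexOn.1 (hx i) (hy i) ha hb' hab,
      fun x hx y hy a b ha hb' hab => ?_⟩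
    simp only [fullF, smul_eq_mul, Finset.mul_sum, ← Finset.sum_add_distrib]
    exact Finset.sum_le_sum fun i _ => (hF i).convexOn.2 (hx i) (hy i) ha hb' hab
  closed := by
    -- Each summand is bounded below, so an upper bound on the sum bounds every summand above. The
    -- epigraph of the sum thus lies in a closed set on which the sum is continuous.
    have hmin : ∀ i, ∃ μ, ∀ x ∈ interior (P.X i), μ ≤ P.F i x := by
      intro i
      obtain ⟨x, -, h⟩ := (hF i).exists_min ((hb i).subset interior_subset) (hne i) 0
      exact ⟨P.F i x, fun y hy => by simpa using h y hy⟩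
    choose μ hμ using hmin
    set S : Set (PrimalVec n × ℝ) := {p | ∀ i, block p.1 i ∈ interior (P.X i) ∧
      P.F i (block p.1 i) ≤ p.2 - ∑ j ∈ Finset.univ.erase i, μ j} with hS
    have hSc : IsClosed S := by
      have : S = ⋂ i, (fun p : PrimalVec n × ℝ =>
          (blockCLM n i p.1, p.2 - ∑ j ∈ Finset.univ.erase i, μ j)) ⁻¹'
          {p | p.1 ∈ interior (P.X i) ∧ P.F i p.1 ≤ p.2} := by
        ext p; simp [hS, blockCLM_apply]
      rw [this]
      exact isClosed_iInter fun i => (hF i).closed.preimage (by fun_prop)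
    have hcont : ContinuousOn (fun p : PrimalVec n × ℝ => P.fullF p.1) S := by
      simp only [fullF]
      refine continuousOn_finsetSum _ fun i _ => ?_
      exact (hF i).contDiffOn.continuousOn.comp
        ((blockCLM n i).continuous.comp continuous_fst).continuousOn fun p hp => (hp i).1
    have := hSc.isClosed_le hcont continuousOn_snd
    convert! this using 1
    ext p
    constructor
    · rintro ⟨h1, h2⟩
      refine ⟨fun i => ⟨h1 i, ?_⟩, h2⟩
      have h3 : ∑ j ∈ Finset.univ.erase i, μ j ≤
          ∑ j ∈ Finset.univ.erase i, P.F j (block p.1 j) :=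
        Finset.sum_le_sum fun j _ => hμ j _ (h1 j)
      have h4 := Finset.add_sum_erase Finset.univ (fun j => P.F j (block p.1 j))
        (Finset.mem_univ i)
      simp only [fullF] at h2
      linarith
    · exact fun h => ⟨fun i => (h.1 i).1, h.2⟩
  third_le := by
    intro x hx u
    rw [iteratedFDeriv_fullF hF hx le_rfl]
    have e : ∀ i, (fun j => block ((![u, u, u] : Fin 3 → PrimalVec n) j) i)
        = ![block u i, block u i, block u i] := by
      intro i; ext j; fin_cases j <;> rfl
    simp only [e]
    set N := localNorm P.fullF x u with hN
    have hq : ∀ i, localNorm (P.F i) (block x i) (block u i) ^ 2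
        = block u i ⬝ᵥ (hess (P.F i) (block x i) *ᵥ block u i) := fun i =>
      matNorm_sq ((hF i).hess_posSemidef (hx i)) _
    have hsum : u ⬝ᵥ (hess P.fullF x *ᵥ u)
        = ∑ i, localNorm (P.F i) (block x i) (block u i) ^ 2 := by
      rw [dotProduct_hess_fullF hF hx]
      exact Finset.sum_congr rfl fun i _ => (hq i).symm
    have hN2 : N ^ 2 = ∑ i, localNorm (P.F i) (block x i) (block u i) ^ 2 := by
      rw [← hsum]
      exact Real.sq_sqrt (by rw [hsum]; exact Finset.sum_nonneg fun i _ => sq_nonneg _)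
    have hN0 : 0 ≤ N := Real.sqrt_nonneg _
    -- Each block norm is at most `N`, so the sum of their cubes is at most `N` times the sum of
    -- their squares, that is `N³`.
    have hle : ∀ i, localNorm (P.F i) (block x i) (block u i) ≤ N := fun i => by
      refine le_of_sq_le_sq ?_ hN0
      rw [hN2]
      exact Finset.single_le_sum (f := fun i => localNorm (P.F i) (block x i) (block u i) ^ 2)
        (fun i _ => sq_nonneg _) (Finset.mem_univ i)
    calc |∑ i, iteratedFDeriv ℝ 3 (P.F i) (block x i) ![block u i, block u i, block u i]|
        ≤ ∑ i, 2 * (N * localNorm (P.F i) (block x i) (block u i) ^ 2) := by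
          refine (Finset.abs_sum_le_sum_abs _ _).trans (Finset.sum_le_sum fun i _ => ?_)
          refine ((hF i).third_le _ (hx i) _).trans ?_
          rw [pow_succ' _ 2]
          have := hle i
          gcongr
      _ = 2 * N ^ 3 := by
          rw [← Finset.mul_sum, ← Finset.mul_sum, ← hN2]; ring

end SeparableProblem

/-! ### Scalar estimates for the main bound. -/

section Bound

theorem xi_nonneg {a D l : ℝ} (hD : 0 ≤ D) (hl : 0 ≤ l) (h : a + 2 * D + l < 1) :
    0 ≤ xi a D l :=
  div_nonneg (add_nonneg hD hl) (by linarith)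

theorem xi_mono {a b D E l k : ℝ} (hab : a ≤ b) (hD : 0 ≤ D) (hDE : D ≤ E)
    (hl : 0 ≤ l) (hlk : l ≤ k) (h : b + 2 * E + k < 1) : xi a D l ≤ xi b E k :=
  div_le_div₀ (by linarith) (by linarith) (by linarith) (by linarith)

theorem mainBound_mono {a b a₁ b₁ D E l k : ℝ} (ha : 0 ≤ a) (hab : a ≤ b) (ha₁ : 0 ≤ a₁)
    (hab₁ : a₁ ≤ b₁) (hD : 0 ≤ D) (hDE : D ≤ E) (hl : 0 ≤ l) (hlk : l ≤ k)
    (h : b₁ + 2 * E + k < 1) (hb : b < 1) : mainBound a a₁ D l ≤ mainBound b b₁ E k := by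
  have h0 : 0 ≤ xi a₁ D l := xi_nonneg hD hl (by linarith)
  have h1 : xi a₁ D l ≤ xi b₁ E k := xi_mono hab₁ hD hDE hl hlk h
  have hb1 : 0 < 1 - b := by linarith
  have hb2 : 0 < 1 - b₁ := by linarith
  have ha1 : 0 < 1 - a := by linarith
  have ha2 : 0 < 1 - a₁ := by linarith
  have hb0 : 0 ≤ b₁ := ha₁.trans hab₁
  have hb3 : 0 ≤ b₁ * (((1 - b₁) ^ 2)⁻¹ + 2 * (1 - b₁)⁻¹) := by positivity
  unfold mainBound
  gcongr

/-- The scalar estimate behind the main bound. -/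
theorem step_bound_le {σ δ ξ : ℝ} (hσ : 0 ≤ σ) (hσ1 : σ < 1) (hδ : 0 ≤ δ) (hδ1 : δ < 1)
    (hξ : σ / (1 - σ) ≤ ξ) :
    (1 - σ)⁻¹ * δ + (σ / (1 - σ)) ^ 2 + (1 - σ)⁻¹ * ((((1 - δ) ^ 2)⁻¹ - 1) * σ) ≤
      δ + ξ ^ 2 + δ * (((1 - δ) ^ 2)⁻¹ + 2 * (1 - δ)⁻¹) * ξ := by
  have h1 : (0 : ℝ) < 1 - σ := by linarith
  have h2 : (0 : ℝ) < 1 - δ := by linarith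
  have e1 : (1 - σ)⁻¹ = 1 + σ / (1 - σ) := by field_simp; ring
  have e2 : (1 - σ)⁻¹ * ((((1 - δ) ^ 2)⁻¹ - 1) * σ)
      = (((1 - δ) ^ 2)⁻¹ - 1) * (σ / (1 - σ)) := by ring
  rw [e2, e1]
  have hτ : 0 ≤ σ / (1 - σ) := div_nonneg hσ h1.le
  set τ := σ / (1 - σ)
  have e3 : ((1 - δ) ^ 2)⁻¹ - 1 = δ * (((1 - δ) ^ 2)⁻¹ + (1 - δ)⁻¹) := by field_simp; ring
  have h3 : 1 ≤ (1 - δ)⁻¹ := (one_le_inv₀ h2).2 (by linarith)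
  -- The linear coefficient of `τ` combines the mismatch factor with the `δ` from `(1-σ)⁻¹δ = δ +
  -- δτ`, and `δ ≤ δ/(1-δ)` gives the coefficient 2.
  have h4 : δ + (((1 - δ) ^ 2)⁻¹ - 1) ≤ δ * (((1 - δ) ^ 2)⁻¹ + 2 * (1 - δ)⁻¹) := by
    rw [e3]; nlinarith [mul_le_mul_of_nonneg_left h3 hδ]
  have h5 : 0 ≤ δ * (((1 - δ) ^ 2)⁻¹ + 2 * (1 - δ)⁻¹) := by positivity
  have h6 := mul_le_mul_of_nonneg_right h4 hτ
  have h7 := mul_le_mul_of_nonneg_left hξ h5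
  have h8 := pow_le_pow_left₀ hτ hξ 2
  linarith

/-- The denominator of `ξ` comes from `(1-δ)(1-Δ) ≥ 1-δ-Δ`, that is from discarding `δΔ`. -/
theorem div_one_sub_le_xi {σ δ Δ l : ℝ} (hδ : 0 ≤ δ) (hΔ : 0 ≤ Δ) (hl : 0 ≤ l)
    (h : δ + 2 * Δ + l < 1) (hσ : σ * ((1 - δ) * (1 - Δ)) ≤ Δ + l) :
    σ < 1 ∧ σ / (1 - σ) ≤ xi δ Δ l := by
  have hδΔ : 0 ≤ δ * Δ := mul_nonneg hδ hΔ
  have h1 : 0 < (1 - δ) * (1 - Δ) := mul_pos (by linarith) (by linarith)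
  have h2 : σ < 1 := by
    by_contra hc
    nlinarith [mul_le_mul_of_nonneg_right (not_lt.1 hc) h1.le]
  refine ⟨h2, ?_⟩
  rw [xi, div_le_div_iff₀ (by linarith) (by linarith)]
  rcases le_or_gt σ 0 with h3 | h3
  · nlinarith [mul_nonneg (neg_nonneg.2 h3) (by linarith : (0 : ℝ) ≤ 1 - δ - 2 * Δ - l),
      mul_nonneg (add_nonneg hΔ hl) (by linarith : (0 : ℝ) ≤ 1 - σ)]
  · nlinarith [mul_nonneg h3.le hδΔ]

end Bound

/-! ### The inexact Newton step for one self-concordant function. -/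

section Step

variable {κ ι : Type*} [Fintype κ] [DecidableEq κ] [Fintype ι] [DecidableEq ι]
  {f : (κ → ℝ) → ℝ} {D : Set (κ → ℝ)}

/-- One inexact Newton step in the dual, for a self-concordant function on a bounded domain:
`x` is the old approximation, `x₁` the intermediate one with exact counterpart `a`, and `x₂` the
new one with exact counterpart `c`. -/
theorem IsSelfConcordant.inexact_step (hf : IsSelfConcordant D f) (hD : Bornology.IsBounded D)
    {A : Matrix ι κ ℝ} (hA : A.rank = Fintype.card ι) (b : ι → ℝ) {x x₁ x₂ a c : κ → ℝ}
    (hx : x ∈ D) (ha : a ∈ D) (hc : c ∈ D) {δp δ₁ Δ l : ℝ}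
    (hΔ : Δ = matNorm (hess f x) (x₁ - x)) (hδ₁ : δ₁ = matNorm (hess f a) (x₁ - a))
    (hδp : δp = matNorm (hess f c) (x₂ - c))
    (hl : l = dualNorm (A * (hess f x)⁻¹ * Aᵀ) (A *ᵥ x - b))
    (hstep : grad f c =
      grad f a + -(Aᵀ *ᵥ ((A * (hess f x₁)⁻¹ * Aᵀ)⁻¹ *ᵥ (A *ᵥ x₁ - b))))
    (h1 : δ₁ + 2 * Δ + l < 1) (h2 : δp < 1) :
    dualNorm (A * (hess f x₂)⁻¹ * Aᵀ) (A *ᵥ x₂ - b) ≤ mainBound δp δ₁ Δ l := by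
  have hΔ0 : 0 ≤ Δ := hΔ ▸ matNorm_nonneg _ _
  have hδ₁0 : 0 ≤ δ₁ := hδ₁ ▸ matNorm_nonneg _ _
  have hδp0 : 0 ≤ δp := hδp ▸ matNorm_nonneg _ _
  have hl0 : 0 ≤ l := hl ▸ matNorm_nonneg _ _
  have hΔ1 : Δ < 1 := by linarith
  have hδ₁1 : δ₁ < 1 := by linarith
  have hx₁ : x₁ ∈ D := by
    have := hf.add_mem_of_matNorm_lt_one hx (h := x₁ - x) (hΔ ▸ hΔ1)
    rwa [add_sub_cancel] at this
  have hx₂ : x₂ ∈ D := by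
    have := hf.add_mem_of_matNorm_lt_one hc (h := x₂ - c) (hδp ▸ h2)
    rwa [add_sub_cancel] at this
  have px := hf.hess_posDef hD hx
  have px₁ := hf.hess_posDef hD hx₁
  have px₂ := hf.hess_posDef hD hx₂
  have pa := hf.hess_posDef hD ha
  have pc := hf.hess_posDef hD hc
  have k₁ := fun u => (hf.hess_dikin hD hx (h := x₁ - x) (hΔ ▸ hΔ1) u).1
  have ka := hf.hess_dikin hD ha (h := x₁ - a) (hδ₁ ▸ hδ₁1)
  have kc := fun u => (hf.hess_dikin hD hc (h := x₂ - c) (hδp ▸ h2) u).1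
  simp only [add_sub_cancel, ← hΔ, ← hδ₁, ← hδp] at k₁ ka kc
  have pS := PosDef.mul_inv_mul_transpose px hA
  have pS₁ := PosDef.mul_inv_mul_transpose px₁ hA
  set S₁ := A * (hess f x₁)⁻¹ * Aᵀ with hS₁
  set g₁ := A *ᵥ x₁ - b with hg₁
  set v := -(Aᵀ *ᵥ (S₁⁻¹ *ᵥ g₁)) with hv
  -- Moving from `x` to `x₁` adds at most `Δ` to the residual norm, and changing the metric costs
  -- `(1-Δ)⁻¹`.
  have hl₁ : dualNorm S₁ g₁ ≤ (1 - Δ)⁻¹ * (Δ + l) := by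
    refine (dualNorm_le_of_matNorm_le px px₁ hA k₁ g₁).trans ?_
    have e : g₁ = A *ᵥ (x₁ - x) + (A *ᵥ x - b) := by
      rw [hg₁, Matrix.mulVec_sub]; abel
    have : dualNorm (A * (hess f x)⁻¹ * Aᵀ) g₁ ≤ Δ + l := by
      rw [e, hl, hΔ]
      exact (matNorm_add_le pS.inv _ _).trans
        (add_le_add_left (dualNorm_mulVec_le px hA _) _)
    exact mul_le_mul_of_nonneg_left this (inv_nonneg.2 (by linarith))
  have hvn : matNorm (hess f x₁)⁻¹ v = dualNorm S₁ g₁ := by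
    rw [hv, matNorm_neg, matNorm_transpose_mulVec, ← hS₁, matNorm_mulVec_inv pS₁]
    rfl
  set σ := matNorm (hess f a)⁻¹ v with hσ
  have hσ0 : 0 ≤ σ := matNorm_nonneg _ _
  have hσle : σ * ((1 - δ₁) * (1 - Δ)) ≤ Δ + l := by
    have h3 := matNorm_inv_le pa px₁ (fun u => (ka u).1) v
    rw [hvn, ← hσ] at h3
    have h4 : 0 < 1 - δ₁ := by linarith
    have h5 : 0 < 1 - Δ := by linarith
    have h6 := h3.trans (mul_le_mul_of_nonneg_left hl₁ (inv_nonneg.2 h4.le))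
    calc σ * ((1 - δ₁) * (1 - Δ))
        ≤ ((1 - δ₁)⁻¹ * ((1 - Δ)⁻¹ * (Δ + l))) * ((1 - δ₁) * (1 - Δ)) := by gcongr
      _ = Δ + l := by field_simp
  obtain ⟨hσ1, hξ⟩ := div_one_sub_le_xi hδ₁0 hΔ0 hl0 h1 hσle
  obtain ⟨hcomp, hnewton⟩ := hf.newton_error hD ha hc hstep hσ1
  have hcomp' : ∀ u, matNorm (hess f c) u ≤ (1 - σ)⁻¹ * matNorm (hess f a) u := fun u => by
    rw [← div_eq_inv_mul, le_div_iff₀ (by linarith), mul_comm]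
    exact hcomp u
  set w := c - x₁ - (hess f x₁)⁻¹ *ᵥ v with hw
  -- The Newton step solves the linearization at `x₁`, so `g₁` cancels and only images of errors
  -- remain.
  have hAw : A *ᵥ x₂ - b = A *ᵥ (x₂ - c + w) := by
    have e1 : A *ᵥ ((hess f x₁)⁻¹ *ᵥ v) = -g₁ := by
      rw [hv, Matrix.mulVec_neg, Matrix.mulVec_neg, Matrix.mulVec_mulVec, Matrix.mulVec_mulVec,
        PosDef.mulVec_inv_mulVec pS₁]
    rw [hw, Matrix.mulVec_add, Matrix.mulVec_sub, Matrix.mulVec_sub, Matrix.mulVec_sub, e1, hg₁]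
    abel
  have hwle : matNorm (hess f c) w ≤
      δ₁ + xi δ₁ Δ l ^ 2 + δ₁ * (((1 - δ₁) ^ 2)⁻¹ + 2 * (1 - δ₁)⁻¹) * xi δ₁ Δ l := by
    refine le_trans ?_ (step_bound_le hσ0 hσ1 hδ₁0 hδ₁1 hξ)
    have e : w = -(x₁ - a) + (c - a - (hess f a)⁻¹ *ᵥ v)
        + ((hess f a)⁻¹ - (hess f x₁)⁻¹) *ᵥ v := by
      rw [hw, Matrix.sub_mulVec]; abel
    rw [e]
    refine (matNorm_add_le pc _ _).trans (add_le_add ((matNorm_add_le pc _ _).trans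
      (add_le_add ?_ hnewton)) ?_)
    · rw [matNorm_neg, hδ₁]; exact hcomp' _
    · refine (hcomp' _).trans (mul_le_mul_of_nonneg_left ?_ (inv_nonneg.2 (by linarith)))
      exact matNorm_inv_sub_inv_le pa px₁ (by linarith) (by linarith) (fun u => (ka u).1)
        (fun u => (ka u).2) v
  calc dualNorm (A * (hess f x₂)⁻¹ * Aᵀ) (A *ᵥ x₂ - b)
      ≤ matNorm (hess f x₂) (x₂ - c + w) := by rw [hAw]; exact dualNorm_mulVec_le px₂ hA _
    _ ≤ (1 - δp)⁻¹ * matNorm (hess f c) (x₂ - c + w) := kc _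
    _ ≤ (1 - δp)⁻¹ * (δp + matNorm (hess f c) w) := by
        refine mul_le_mul_of_nonneg_left ?_ (inv_nonneg.2 (by linarith))
        rw [hδp]; exact matNorm_add_le pc _ _
    _ ≤ mainBound δp δ₁ Δ l := by
        rw [mainBound]
        refine mul_le_mul_of_nonneg_left ?_ (inv_nonneg.2 (by linarith))
        linarith

end Step

theorem dualNorm_smul_smul {ι : Type*} [Fintype ι] [DecidableEq ι] {S : Matrix ι ι ℝ}
    (hS : S.PosDef) {s : ℝ} (hs : 0 < s) (g : ι → ℝ) :
    dualNorm (s • s • S) (s • g) = dualNorm S g := by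
  have hd := PosDef.isUnit_det hS
  have e : (s • s • S)⁻¹ = s⁻¹ • s⁻¹ • S⁻¹ := by
    refine Matrix.inv_eq_left_inv ?_
    rw [Matrix.smul_mul, Matrix.smul_mul, Matrix.mul_smul, Matrix.mul_smul,
      Matrix.nonsing_inv_mul _ hd, smul_smul, smul_smul, smul_smul]
    rw [show s⁻¹ * s⁻¹ * s * s = 1 by field_simp, one_smul]
  unfold dualNorm
  rw [e]
  congr 1
  simp only [Matrix.smul_mulVec, Matrix.mulVec_smul, smul_dotProduct, dotProduct_smul, smul_eq_mul]
  field_simp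

/-! ### Translation between the dual problem and the inverse gradient of `F`. -/

namespace SeparableProblem

variable {M m : ℕ} {n : Fin M → ℕ} (P : SeparableProblem M m n)

/-- The cost vector `c = (c₁, …, c_M)`. -/
def fullC : PrimalVec n := fun p => P.c p.1 p.2

/-- The matrix `S(x) = A ∇²F(x)⁻¹ Aᵀ`. -/
def schur (x : PrimalVec n) : Matrix (Fin m) (Fin m) ℝ :=
  P.fullA * (hess P.fullF x)⁻¹ * P.fullAᵀ

/-- The gradient of `F` at the solution `x*(y,t)`. -/
def slope (y : Fin m → ℝ) (t : ℝ) : PrimalVec n := t⁻¹ • P.fullC + (t⁻¹ • P.fullA)ᵀ *ᵥ y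

variable {P}

theorem sum_subObjective (y : Fin m → ℝ) {t : ℝ} (ht : 0 < t) (x : PrimalVec n) :
    ∑ i, P.subObjective i y t (block x i) =
      t * (P.slope y t ⬝ᵥ x - P.fullF x + ∑ i, P.F i (P.analyticCenter i)) := by
  have e1 : P.fullC ⬝ᵥ x = ∑ i, P.c i ⬝ᵥ block x i := by
    simp only [dotProduct, fullC, block, Fintype.sum_sigma]
  have e2 : P.fullA *ᵥ x = ∑ i, P.A i *ᵥ block x i := by
    ext r
    simp only [Matrix.mulVec, dotProduct, fullA, block, Fintype.sum_sigma, Finset.sum_apply,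
      Matrix.of_apply]
  have e3 : P.slope y t ⬝ᵥ x = t⁻¹ * (P.fullC ⬝ᵥ x + y ⬝ᵥ (P.fullA *ᵥ x)) := by
    rw [slope, add_dotProduct, smul_dotProduct, Matrix.mulVec_transpose, ← Matrix.dotProduct_mulVec,
      Matrix.smul_mulVec, dotProduct_smul, smul_eq_mul, smul_eq_mul, mul_add]
  rw [e3, mul_add, mul_sub, mul_inv_cancel_left₀ ht.ne', e1, e2, dotProduct_sum]
  simp only [subObjective, fullF, Finset.sum_sub_distrib, Finset.sum_add_distrib, ← Finset.mul_sum]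
  ring

theorem xstar_spec (hF : ∀ i, IsSelfConcordant (interior (P.X i)) (P.F i))
    (hb : ∀ i, Bornology.IsBounded (P.X i)) (hne : ∀ i, (interior (P.X i)).Nonempty)
    (y : Fin m → ℝ) {t : ℝ} (ht : 0 < t) (i : Fin M) :
    block (P.xstar y t) i ∈ interior (P.X i) ∧
      IsMaxOn (P.subObjective i y t) (interior (P.X i)) (block (P.xstar y t) i) := by
  obtain ⟨x, hx, hmin⟩ := (hF i).exists_min ((hb i).subset interior_subset) (hne i)
    (t⁻¹ • (P.c i + (P.A i)ᵀ *ᵥ y))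
  have e : ∀ z, P.subObjective i y t z = t * (P.F i (P.analyticCenter i)
      - (P.F i z - (t⁻¹ • (P.c i + (P.A i)ᵀ *ᵥ y)) ⬝ᵥ z)) := by
    intro z
    rw [smul_dotProduct, add_dotProduct, Matrix.mulVec_transpose, ← Matrix.dotProduct_mulVec,
      smul_eq_mul, subObjective]
    field_simp
    ring
  have h : ∃ x, x ∈ interior (P.X i) ∧ IsMaxOn (P.subObjective i y t) (interior (P.X i)) x := by
    refine ⟨x, hx, fun z hz => ?_⟩
    have := hmin z hz
    simp only [Set.mem_ofPred_eq, e]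
    gcongr
  exact Classical.epsilon_spec h

theorem xstar_mem (hF : ∀ i, IsSelfConcordant (interior (P.X i)) (P.F i))
    (hb : ∀ i, Bornology.IsBounded (P.X i)) (hne : ∀ i, (interior (P.X i)).Nonempty)
    (y : Fin m → ℝ) {t : ℝ} (ht : 0 < t) : P.xstar y t ∈ P.domF :=
  fun i => (xstar_spec hF hb hne y ht i).1

/-- Blockwise maximality sums to minimality of `F - slopeᵀx`; this is its first-order condition. -/
theorem grad_fullF_xstar (hF : ∀ i, IsSelfConcordant (interior (P.X i)) (P.F i))
    (hb : ∀ i, Bornology.IsBounded (P.X i)) (hne : ∀ i, (interior (P.X i)).Nonempty)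
    (y : Fin m → ℝ) {t : ℝ} (ht : 0 < t) : grad P.fullF (P.xstar y t) = P.slope y t := by
  refine (isSelfConcordant_fullF hF hb hne).grad_eq_of_min (xstar_mem hF hb hne y ht)
    fun z hz => ?_
  have h : ∑ i, P.subObjective i y t (block z i) ≤
      ∑ i, P.subObjective i y t (block (P.xstar y t) i) :=
    Finset.sum_le_sum fun i _ => (xstar_spec hF hb hne y ht i).2 (hz i)
  rw [sum_subObjective y ht, sum_subObjective y ht] at h
  linarith [le_of_mul_le_mul_left h ht]

theorem xstar_eq_gradInv (hF : ∀ i, IsSelfConcordant (interior (P.X i)) (P.F i))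
    (hb : ∀ i, Bornology.IsBounded (P.X i)) (hne : ∀ i, (interior (P.X i)).Nonempty)
    (y : Fin m → ℝ) {t : ℝ} (ht : 0 < t) :
    P.xstar y t = gradInv P.fullF P.domF (P.slope y t) := by
  rw [← grad_fullF_xstar hF hb hne y ht, (isSelfConcordant_fullF hF hb hne).gradInv_grad
    (isBounded_domF hb) (xstar_mem hF hb hne y ht)]

theorem smoothDual_eq (hF : ∀ i, IsSelfConcordant (interior (P.X i)) (P.F i))
    (hb : ∀ i, Bornology.IsBounded (P.X i)) (hne : ∀ i, (interior (P.X i)).Nonempty)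
    (y : Fin m → ℝ) {t : ℝ} (ht : 0 < t) :
    t⁻¹ * P.smoothDual y t = conjugate P.fullF P.domF (P.slope y t)
      + ∑ i, P.F i (P.analyticCenter i) - (t⁻¹ • P.b) ⬝ᵥ y := by
  have h : ∀ i, sSup (P.subObjective i y t '' interior (P.X i))
      = P.subObjective i y t (block (P.xstar y t) i) := fun i => by
    obtain ⟨hmem, hmax⟩ := xstar_spec hF hb hne y ht i
    exact IsGreatest.csSup_eq ⟨⟨_, hmem, rfl⟩, by rintro _ ⟨z, hz, rfl⟩; exact hmax hz⟩
  simp only [smoothDual, h]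
  rw [sum_subObjective y ht, xstar_eq_gradInv hF hb hne y ht, conjugate, mul_sub,
    inv_mul_cancel_left₀ ht.ne', smul_dotProduct, smul_eq_mul]

/-- The matrix carries `t⁻²` and the vector `t⁻¹`, so the scaling cancels in the dual norm. -/
theorem inexactDecrement_eq (hsc : IsSelfConcordant P.domF P.fullF)
    (hD : Bornology.IsBounded P.domF) (hrank : P.fullA.rank = m) {x : PrimalVec n}
    (hx : x ∈ P.domF) {t : ℝ} (ht : 0 < t) :
    P.inexactDecrement x t = dualNorm (P.schur x) (P.fullA *ᵥ x - P.b) :=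
  dualNorm_smul_smul (PosDef.mul_inv_mul_transpose (hsc.hess_posDef hD hx) (by simpa using hrank))
    (inv_pos.2 ht) _

/-- The exact Newton decrement is the one computed from the exact solution. -/
theorem decrement_eq (hF : ∀ i, IsSelfConcordant (interior (P.X i)) (P.F i))
    (hb : ∀ i, Bornology.IsBounded (P.X i)) (hne : ∀ i, (interior (P.X i)).Nonempty)
    (y : Fin m → ℝ) {t : ℝ} (ht : 0 < t) :
    P.decrement y t = P.inexactDecrement (P.xstar y t) t := by
  have h := (isSelfConcordant_fullF hF hb hne).grad_hess_conjugate_comp (isBounded_domF hb)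
    (domF_nonempty hne) (t⁻¹ • P.fullC) (t⁻¹ • P.fullA) (t⁻¹ • P.b)
    (∑ i, P.F i (P.analyticCenter i)) y
  have e : (fun z => t⁻¹ * P.smoothDual z t) = fun z => conjugate P.fullF P.domF
      (t⁻¹ • P.fullC + (t⁻¹ • P.fullA)ᵀ *ᵥ z) + ∑ i, P.F i (P.analyticCenter i)
      - (t⁻¹ • P.b) ⬝ᵥ z := funext fun z => smoothDual_eq hF hb hne z ht
  have ex : gradInv P.fullF P.domF (t⁻¹ • P.fullC + (t⁻¹ • P.fullA)ᵀ *ᵥ y) = P.xstar y t :=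
    (xstar_eq_gradInv hF hb hne y ht).symm
  rw [decrement, newtonDecrement, e, h.1, h.2, ex, inexactDecrement]
  congr 1
  · simp only [inexactHess, Matrix.transpose_smul, Matrix.smul_mul, Matrix.mul_smul]
  · rw [inexactGrad, Matrix.smul_mulVec, smul_sub]

/-- The inverse of `t⁻¹S` contributes a factor `t` that cancels the `t⁻¹` in the slope, so the shift
is the same for every `t`. -/
theorem slope_step (hsc : IsSelfConcordant P.domF P.fullF)
    (hD : Bornology.IsBounded P.domF) (hrank : P.fullA.rank = m) {x : PrimalVec n}
    (hx : x ∈ P.domF) {t : ℝ} (ht : 0 < t) (y : Fin m → ℝ) :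
    P.slope (y - (P.inexactHess x t)⁻¹ *ᵥ P.inexactGrad x) t =
      P.slope y t + -(P.fullAᵀ *ᵥ ((P.schur x)⁻¹ *ᵥ (P.fullA *ᵥ x - P.b))) := by
  have hS : (P.schur x).PosDef :=
    PosDef.mul_inv_mul_transpose (hsc.hess_posDef hD hx) (by simpa using hrank)
  have e : (P.inexactHess x t)⁻¹ = t • (P.schur x)⁻¹ := by
    refine Matrix.inv_eq_left_inv ?_
    change (t • (P.schur x)⁻¹) * (t⁻¹ • P.schur x) = 1
    rw [Matrix.smul_mul, Matrix.mul_smul, Matrix.nonsing_inv_mul _ (PosDef.isUnit_det hS),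
      smul_smul, mul_inv_cancel₀ ht.ne', one_smul]
  rw [slope, slope, e, Matrix.mulVec_sub, Matrix.smul_mulVec, Matrix.mulVec_smul,
    Matrix.transpose_smul, Matrix.smul_mulVec, Matrix.smul_mulVec, smul_smul,
    mul_inv_cancel₀ ht.ne', one_smul, inexactGrad]
  abel

theorem eq_xstar_of_solError_eq_zero (hF : ∀ i, IsSelfConcordant (interior (P.X i)) (P.F i))
    (hb : ∀ i, Bornology.IsBounded (P.X i)) (hne : ∀ i, (interior (P.X i)).Nonempty)
    {x : PrimalVec n} {y : Fin m → ℝ} {t : ℝ} (ht : 0 < t) (h : P.solError x y t = 0) :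
    x = P.xstar y t :=
  sub_eq_zero.1 (eq_zero_of_matNorm_eq_zero ((isSelfConcordant_fullF hF hb hne).hess_posDef
    (isBounded_domF hb) (xstar_mem hF hb hne y ht)) h)

end SeparableProblem

end PathFollowing

end

/-! ### The theorem. -/

open PathFollowing in
theorem mainTheorem1 {M m : ℕ} {n : Fin M → ℕ} (P : SeparableProblem M m n) (ν : Fin M → ℝ)
    (hclosed : ∀ i, IsClosed (P.X i)) (hconvex : ∀ i, Convex ℝ (P.X i))
    (hbounded : ∀ i, Bornology.IsBounded (P.X i))
    (hinterior : ∀ i, (interior (P.X i)).Nonempty)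
    (hbarrier : ∀ i, IsSelfConcordantBarrier (P.X i) (P.F i) (ν i))
    (hrank : P.fullA.rank = m)
    -- the inexact primal solutions `x̄(y,t)`
    (xbar : (Fin m → ℝ) → ℝ → PrimalVec n)
    (y : Fin m → ℝ) (t Δt : ℝ) (hΔt : 0 < Δt) (hΔt_lt : Δt < t)
    (hxbar : xbar y t ∈ P.domF)
    -- one step of the path-following method
    (tp : ℝ) (htp : tp = t - Δt)
    (yp : Fin m → ℝ)
    (hyp : yp = y - (P.inexactHess (xbar y tp) tp)⁻¹ *ᵥ P.inexactGrad (xbar y tp))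
    -- the quantities in the estimate
    (lbar lbarp lam lamp δ δ₁ δp Δ Δstar : ℝ)
    (hlbar : lbar = P.inexactDecrement (xbar y t) t)
    (hlbarp : lbarp = P.inexactDecrement (xbar yp tp) tp)
    (hlam : lam = P.decrement y t)
    (hlamp : lamp = P.decrement yp tp)
    (hδ : δ = P.solError (xbar y t) y t)
    (hδ₁ : δ₁ = P.solError (xbar y tp) y tp)
    (hδp : δp = P.solError (xbar yp tp) yp tp)
    (hΔ : Δ = localNorm P.fullF (xbar y t) (xbar y tp - xbar y t))
    (hΔstar : Δstar = localNorm P.fullF (P.xstar y t) (P.xstar y tp - P.xstar y t)) :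
    -- the main estimate
    (δ₁ + 2 * Δ + lbar < 1 → δp < 1 → lbarp ≤ mainBound δp δ₁ Δ lbar) ∧
    -- its right-hand side is nondecreasing in every variable
    (∀ a b a₁ b₁ D E l k : ℝ, 0 ≤ a → a ≤ b → 0 ≤ a₁ → a₁ ≤ b₁ → 0 ≤ D → D ≤ E →
      0 ≤ l → l ≤ k → b₁ + 2 * E + k < 1 → b < 1 →
      mainBound a a₁ D l ≤ mainBound b b₁ E k) ∧
    -- the exact case
    (δ = 0 → δ₁ = 0 → δp = 0 →
      lbarp = lamp ∧ lbar = lam ∧ Δ = Δstar ∧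
      (lam + 2 * Δstar < 1 →
        lamp ≤ ((lam + Δstar) / (1 - 2 * Δstar - lam)) ^ 2)) := by
  have ht : 0 < t := hΔt.trans hΔt_lt
  have htp0 : 0 < tp := by rw [htp]; linarith
  have hF : ∀ i, IsSelfConcordant (interior (P.X i)) (P.F i) := fun i => (hbarrier i).selfConcordant
  have hsc := SeparableProblem.isSelfConcordant_fullF hF hbounded hinterior
  have hD := SeparableProblem.isBounded_domF hbounded
  have main : δ₁ + 2 * Δ + lbar < 1 → δp < 1 → lbarp ≤ mainBound δp δ₁ Δ lbar := by
    intro h1 h2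
    have hlbar0 : 0 ≤ lbar := hlbar ▸ Real.sqrt_nonneg _
    have hΔ0 : 0 ≤ Δ := hΔ ▸ Real.sqrt_nonneg _
    have hδ₁0 : 0 ≤ δ₁ := hδ₁ ▸ Real.sqrt_nonneg _
    have hx₁ : xbar y tp ∈ P.domF := by
      have := hsc.add_mem_of_matNorm_lt_one hxbar (h := xbar y tp - xbar y t)
        (by rw [← localNorm_eq_matNorm, ← hΔ]; linarith)
      rwa [add_sub_cancel] at this
    have hc := SeparableProblem.xstar_mem hF hbounded hinterior yp htp0
    have hx₂ : xbar yp tp ∈ P.domF := by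
      have := hsc.add_mem_of_matNorm_lt_one hc (h := xbar yp tp - P.xstar yp tp)
        (lt_of_eq_of_lt hδp.symm h2)
      rwa [add_sub_cancel] at this
    rw [SeparableProblem.inexactDecrement_eq hsc hD hrank hxbar ht] at hlbar
    rw [hlbarp, SeparableProblem.inexactDecrement_eq hsc hD hrank hx₂ htp0]
    refine hsc.inexact_step hD (by simpa using hrank) P.b hxbar
      (SeparableProblem.xstar_mem hF hbounded hinterior y htp0) hc hΔ hδ₁ hδp hlbar ?_ h1 h2
    rw [SeparableProblem.grad_fullF_xstar hF hbounded hinterior yp htp0,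
      SeparableProblem.grad_fullF_xstar hF hbounded hinterior y htp0, hyp]
    exact SeparableProblem.slope_step hsc hD hrank hx₁ htp0 y
  refine ⟨main, fun a b a₁ b₁ D E l k => mainBound_mono, fun h0 h1 hp => ?_⟩
  have e0 := SeparableProblem.eq_xstar_of_solError_eq_zero hF hbounded hinterior ht (hδ ▸ h0)
  have e1 := SeparableProblem.eq_xstar_of_solError_eq_zero hF hbounded hinterior htp0 (hδ₁ ▸ h1)
  have ep := SeparableProblem.eq_xstar_of_solError_eq_zero hF hbounded hinterior htp0 (hδp ▸ hp)
  have hl : lbar = lam := by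
    rw [hlbar, hlam, e0, SeparableProblem.decrement_eq hF hbounded hinterior y ht]
  have hlp : lbarp = lamp := by
    rw [hlbarp, hlamp, ep, SeparableProblem.decrement_eq hF hbounded hinterior yp htp0]
  have hΔe : Δ = Δstar := by rw [hΔ, hΔstar, e0, e1]
  refine ⟨hlp, hl, hΔe, fun h => ?_⟩
  -- With both errors zero, `mainBound` collapses to `ξ²`.
  have := main (by rw [h1, hl, hΔe]; linarith) (by rw [hp]; exact one_pos)
  rw [h1, hp, hl, hΔe, hlp] at this
  refine this.trans (le_of_eq ?_)
  simp only [mainBound, xi]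
  ring
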